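/- Let $M$ be a smooth manifold of dimension $n\ge 3$, $T^\circ M$ its slit tangent bundle (nonzero tangent vectors), $\tau:T^\circ M\to M$ the projection and $\Delta=y^i\,\partial/\partial y^i$ the Liouville field. A \emph{spray} is a smooth vector field $\Gamma$ on $T^\circ M$ with $\tau_*\Gamma_{(x,y)}=y$ and $[\Delta,\Gamma]=\Gamma$; in coordinates $(x^i,y^i)$ of $TM$ induced by a chart of $M$ (summing over repeated indices), $\Gamma=y^i\frac{\partial}{\partial x^i}-2\Gamma^i\frac{\partial}{\partial y^i}$. A \emph{projective class} consists of all the sprays of the form $\Gamma-2P\Delta$, where $\Gamma$ is a fixed spray and $P$ is a smooth function on $T^\circ M$ with $\Delta(P)=P$. For a spray $\Gamma$ put $\Gamma^i_j=\frac{\partial\Gamma^i}{\partial y^j}$, $H_i=\frac{\partial}{\partial x^i}-\Gamma^j_i\frac{\partial}{\partial y^j}$, and $$R^j_i=2H_i(\Gamma^j)-\Gamma(\Gamma^j_i)+\Gamma^k_i\Gamma^j_k$$ (the Riemann curvature, determined by $[\Gamma,H_i]=\Gamma^j_iH_j+R^j_i\,\partial/\partial y^j$), $R=\frac1{n-1}R^k_k$,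 $\rho_j=\frac1{n+1}\Big(\frac{\partial R^k_j}{\partial y^k}-\frac{\partial R}{\partial y^j}\Big)$, and let $$W^i_j=R^i_j-R\,\delta^i_j-\rho_j\,y^i$$ be the Weyl curvature. For a tensor field $h$ of type $(0,2)$ along $\tau$, with components $h_{ij}(x,y)$, the dynamical covariant derivative is $(\nabla h)_{ij}=\Gamma(h_{ij})-\Gamma^k_ih_{kj}-\Gamma^k_jh_{ik}$. Let $U\subset M$ be a contractible open subset of a coordinate patch, let a projective class of sprays on $T^\circ M$ be given, and let $\nabla$ and $W$ be the dynamical covariant derivative and the Weyl curvature of any spray in the class. For a smooth tensor field $h$ of type $(0,2)$ along $\tau$ on $T^\circ U$ consider the conditions, required on all of $T^\circ U$ and for all indices, $$h_{ji}=h_{ij},\qquad h_{ij}y^j=0,\qquad \frac{\partial h_{ij}}{\partial y^k}=\frac{\partial h_{ik}}{\partial y^j},\qquad (\nabla h)_{ij}=0,\qquad h_{ik}W^k_j=h_{jk}W^k_i.\tag{$*$}$$ Then there is a smooth function $F$ on $T^\circ U$, positively homogeneous of degree $1$ in $y$, such that every spray $\Gamma$ in the class satisfies the Euler--Lagrange equations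 $\Gamma\big(\frac{\partial F}{\partial y^i}\big)-\frac{\partial F}{\partial x^i}=0$ on $T^\circ U$, if and only if there is a smooth tensor field $h$ satisfying $(*)$. More precisely, a given smooth tensor field $h$ satisfies $(*)$ if and only if there is such a function $F$ whose Hessian is $h$, that is, $h_{ij}=\frac{\partial^2F}{\partial y^i\partial y^j}$ on $T^\circ U$. -/

import Mathlib

open scoped Manifold ContDiff Bundle

/-! ### Sprays on the slit tangent bundle of a manifold -/

namespace SprayGeometry

/-- The coordinate space `ℝⁿ`. -/
abbrev E (n : ℕ) : Type := EuclideanSpace ℝ (Fin n)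

section Manifold

variable {n : ℕ} (M : Type*) [TopologicalSpace M] [ChartedSpace (E n) M]
  [IsManifold (𝓡 n) ∞ M]

/-- The tangent bundle `TM` of the `n`-dimensional smooth manifold `M`. -/
abbrev TM (n : ℕ) (M : Type*) [TopologicalSpace M] [ChartedSpace (E n) M]
    [IsManifold (𝓡 n) ∞ M] : Type _ :=
  TangentBundle (𝓡 n) M

/-- Vector fields on `TM`. The fields that matter are defined and smooth on the slit tangent
bundle only; their values on the zero section play no role. -/
abbrev FieldOnTM (n : ℕ) (M : Type*) [TopologicalSpace M] [ChartedSpace (E n) M]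
    [IsManifold (𝓡 n) ∞ M] : Type _ :=
  (p : TM n M) → TangentSpace (𝓡 n).tangent p

variable {M}

/-- `T°U`: the nonzero tangent vectors with base point in `U`. -/
def slit (U : Set M) : Set (TM n M) := {p | p.1 ∈ U ∧ p.2 ≠ 0}

/-- The Liouville field `Δ`: its value at `p = (x, y)` is the vertical lift of `y`, that is, the
derivative at `y` in the direction `y` of the inclusion of the fibre `TₓM` into `TM`. -/
noncomputable def liouville : FieldOnTM n M := fun p =>
  mfderiv 𝓘(ℝ, E n) (𝓡 n).tangent (fun v : E n => (⟨p.1, v⟩ : TM n M)) p.2 p.2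

/-- A spray: a vector field `Γ`, smooth on `T°M`, such that `τ_* Γ = y` at `y` and
`[Δ, Γ] = Γ`. -/
structure IsSpray (Γ : FieldOnTM n M) : Prop where
  smooth : ContMDiffOn (𝓡 n).tangent (𝓡 n).tangent.tangent ∞
    (fun p => (⟨p, Γ p⟩ : TangentBundle (𝓡 n).tangent (TM n M))) (slit Set.univ)
  proj : ∀ p ∈ slit (n := n) (Set.univ : Set M),
    mfderiv (𝓡 n).tangent (𝓡 n) (fun q : TM n M => q.1) p (Γ p) = p.2
  bracket : ∀ p ∈ slit (n := n) (Set.univ : Set M),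
    VectorField.mlieBracket (𝓡 n).tangent liouville Γ p = Γ p

/-- Projective equivalence: `Γ' = Γ - 2 P Δ` on `T°M` for a smooth function `P` on `T°M` with
`Δ(P) = P`. -/
def ProjEquiv (Γ Γ' : FieldOnTM n M) : Prop :=
  ∃ P : TM n M → ℝ,
    ContMDiffOn (𝓡 n).tangent 𝓘(ℝ, ℝ) ∞ P (slit Set.univ) ∧
    ∀ p ∈ slit (n := n) (Set.univ : Set M),
      mfderiv (𝓡 n).tangent 𝓘(ℝ, ℝ) P p (liouville p) = P p ∧
      Γ' p = Γ p - (2 * P p) • liouville p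

/-- A projective class: all the sprays that are projectively equivalent to a given one. -/
def IsProjectiveClass (S : Set (FieldOnTM n M)) : Prop :=
  ∃ Γ₀, IsSpray Γ₀ ∧ S = {Γ | IsSpray Γ ∧ ProjEquiv Γ₀ Γ}

/-- A smooth function on `T°U` that is positively homogeneous (of degree one) in the fibres. -/
structure IsPosHomogeneous (U : Set M) (F : TM n M → ℝ) : Prop where
  smooth : ContMDiffOn (𝓡 n).tangent 𝓘(ℝ, ℝ) ∞ F (slit U)
  hom : ∀ p ∈ slit U, ∀ t : ℝ, 0 < t → F ⟨p.1, t • p.2⟩ = t * F p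

/-- Type `(0,2)` tensor fields along the projection `τ : TM → M`. -/
abbrev TensorAlong (n : ℕ) (M : Type*) [TopologicalSpace M] [ChartedSpace (E n) M]
    [IsManifold (𝓡 n) ∞ M] : Type _ :=
  (p : TM n M) → LinearMap.BilinForm ℝ (TangentSpace (𝓡 n) p.1)

/-! ### The coordinates `(xⁱ, yⁱ)` on `TM` induced by a chart of `M` -/

/-- The `y`-coordinates of a tangent vector in the chart `e`. -/
noncomputable def fibreCoord (e : OpenPartialHomeomorph M (E n)) (q : TM n M) : E n :=
  mfderiv (𝓡 n) 𝓘(ℝ, E n) e q.1 q.2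

/-- The tangent vector with coordinates `z = (x, y)` in the chart `e`. -/
noncomputable def ofCoord (e : OpenPartialHomeomorph M (E n)) (z : E n × E n) : TM n M :=
  ⟨e.symm z.1, mfderiv 𝓘(ℝ, E n) (𝓡 n) e.symm z.1 z.2⟩

/-- The set of all coordinates `(x, y)` of points of `T°U`. -/
def coordDomain (e : OpenPartialHomeomorph M (E n)) (U : Set M) : Set (E n × E n) :=
  (e '' U) ×ˢ {0}ᶜ

/-- A function on `TM` written in coordinates. -/
noncomputable def coordFun (e : OpenPartialHomeomorph M (E n)) (F : TM n M → ℝ) :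
    E n × E n → ℝ := fun z => F (ofCoord e z)

/-- The derivative `Γ(yⁱ)` of the coordinate function `yⁱ` along the vector field `Γ`, at the
point with coordinates `z`. -/
noncomputable def fieldOfFibreCoord (e : OpenPartialHomeomorph M (E n)) (Γ : FieldOnTM n M)
    (i : Fin n) (z : E n × E n) : ℝ :=
  mfderiv (𝓡 n).tangent 𝓘(ℝ, ℝ) (fun q : TM n M => fibreCoord e q i) (ofCoord e z)
    (Γ (ofCoord e z))

/-- The coefficients `Γⁱ` of `Γ = yⁱ ∂/∂xⁱ - 2 Γⁱ ∂/∂yⁱ` in the chart `e`, that is,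
`Γⁱ = - Γ(yⁱ) / 2`. -/
noncomputable def sprayCoeff (e : OpenPartialHomeomorph M (E n)) (Γ : FieldOnTM n M) (i : Fin n)
    (z : E n × E n) : ℝ :=
  -(1 / 2) * fieldOfFibreCoord e Γ i z

/-- The components `h_{ij} = h(∂/∂xⁱ, ∂/∂xʲ)` of a tensor field along `τ` in the chart `e`. -/
noncomputable def tensorCoeff (e : OpenPartialHomeomorph M (E n)) (h : TensorAlong n M)
    (i j : Fin n) (z : E n × E n) : ℝ :=
  h (ofCoord e z) (mfderiv 𝓘(ℝ, E n) (𝓡 n) e.symm z.1 (EuclideanSpace.single i (1 : ℝ)))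
    (mfderiv 𝓘(ℝ, E n) (𝓡 n) e.symm z.1 (EuclideanSpace.single j (1 : ℝ)))

/-- A tensor field along `τ` is smooth on `T°U`, for `U` in the domain of the chart `e`. -/
def SmoothTensorOn (e : OpenPartialHomeomorph M (E n)) (U : Set M) (h : TensorAlong n M) : Prop :=
  ∀ i j, ContDiffOn ℝ ∞ (tensorCoeff e h i j) (coordDomain e U)

end Manifold

/-! ### Coordinate formulas; `G i` stands for the spray coefficient `Γⁱ` -/

section Coordinates

variable {n : ℕ}

/-- `∂f/∂xⁱ` -/
noncomputable def dx (i : Fin n) (f : E n × E n → ℝ) (z : E n × E n) : ℝ :=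
  fderiv ℝ f z (EuclideanSpace.single i 1, 0)

/-- `∂f/∂yⁱ` -/
noncomputable def dy (i : Fin n) (f : E n × E n → ℝ) (z : E n × E n) : ℝ :=
  fderiv ℝ f z (0, EuclideanSpace.single i 1)

variable (G : Fin n → E n × E n → ℝ)

/-- `Γ(f) = yᵏ ∂f/∂xᵏ - 2 Γᵏ ∂f/∂yᵏ` -/
noncomputable def along (f : E n × E n → ℝ) (z : E n × E n) : ℝ :=
  ∑ k, (z.2 k * dx k f z - 2 * G k z * dy k f z)

/-- `Γⁱⱼ = ∂Γⁱ/∂yʲ` -/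
noncomputable def conn (i j : Fin n) : E n × E n → ℝ := dy j (G i)

/-- `Hᵢ(f) = ∂f/∂xⁱ - Γʲᵢ ∂f/∂yʲ` -/
noncomputable def horiz (i : Fin n) (f : E n × E n → ℝ) (z : E n × E n) : ℝ :=
  dx i f z - ∑ j, conn G j i z * dy j f z

/-- The Riemann curvature (Jacobi endomorphism) `Rʲᵢ`, the vertical part of `[Γ, Hᵢ]`: from
`[Γ, Hᵢ] = Γᵏᵢ Hₖ + Rʲᵢ Vⱼ` one has `Rʲᵢ = 2 Hᵢ(Γʲ) - Γ(Γʲᵢ) + Γᵏᵢ Γʲₖ`. The upper index is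
the first argument. -/
noncomputable def riemann (j i : Fin n) (z : E n × E n) : ℝ :=
  2 * horiz G i (G j) z - along G (conn G j i) z + ∑ k, conn G k i z * conn G j k z

/-- `R = Rᵏₖ / (n - 1)` -/
noncomputable def riemannTrace (z : E n × E n) : ℝ :=
  1 / ((n : ℝ) - 1) * ∑ k, riemann G k k z

/-- `ρⱼ = (∂Rᵏⱼ/∂yᵏ - ∂R/∂yʲ) / (n + 1)` -/
noncomputable def rho (j : Fin n) (z : E n × E n) : ℝ :=
  1 / ((n : ℝ) + 1) * (∑ k, dy k (riemann G k j) z - dy j (riemannTrace G) z)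

/-- The Weyl curvature `Wⁱⱼ = Rⁱⱼ - R δⁱⱼ - ρⱼ yⁱ`. -/
noncomputable def weyl (i j : Fin n) (z : E n × E n) : ℝ :=
  riemann G i j z - riemannTrace G z * (if i = j then 1 else 0) - rho G j z * z.2 i

/-- The dynamical covariant derivative
`(∇h)_{ij} = Γ(h_{ij}) - Γᵏᵢ h_{kj} - Γᵏⱼ h_{ik}`. -/
noncomputable def dynCov (h : Fin n → Fin n → E n × E n → ℝ) (i j : Fin n) (z : E n × E n) : ℝ :=
  along G (h i j) z - ∑ k, conn G k i z * h k j z - ∑ k, conn G k j z * h i k z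

end Coordinates

section Main

variable {n : ℕ} {M : Type*} [TopologicalSpace M] [ChartedSpace (E n) M] [IsManifold (𝓡 n) ∞ M]

/-- `Γ` satisfies the Euler-Lagrange equations `Γ(∂F/∂yⁱ) - ∂F/∂xⁱ = 0` of `F` on `T°U`. -/
def EulerLagrange (e : OpenPartialHomeomorph M (E n)) (U : Set M) (Γ : FieldOnTM n M)
    (F : TM n M → ℝ) : Prop :=
  ∀ z ∈ coordDomain e U, ∀ i,
    along (sprayCoeff e Γ) (dy i (coordFun e F)) z - dx i (coordFun e F) z = 0

/-- `h_{ij} = ∂²F/∂yⁱ∂yʲ` on `T°U`. -/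
def IsHessian (e : OpenPartialHomeomorph M (E n)) (U : Set M) (F : TM n M → ℝ)
    (h : TensorAlong n M) : Prop :=
  ∀ z ∈ coordDomain e U, ∀ i j, tensorCoeff e h i j z = dy i (dy j (coordFun e F)) z

/-- The Helmholtz-like conditions on the tensor `h` with respect to the spray `Γ`, on `T°U`. -/
structure HelmholtzConditions (e : OpenPartialHomeomorph M (E n)) (U : Set M)
    (Γ : FieldOnTM n M) (h : TensorAlong n M) : Prop where
  symm : ∀ z ∈ coordDomain e U, ∀ i j, tensorCoeff e h j i z = tensorCoeff e h i j z
  contract : ∀ z ∈ coordDomain e U, ∀ i, ∑ j, tensorCoeff e h i j z * z.2 j = 0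
  deriv_symm : ∀ z ∈ coordDomain e U, ∀ i j k,
    dy k (tensorCoeff e h i j) z = dy j (tensorCoeff e h i k) z
  dynCov_eq_zero : ∀ z ∈ coordDomain e U, ∀ i j,
    dynCov (sprayCoeff e Γ) (tensorCoeff e h) i j z = 0
  weyl_symm : ∀ z ∈ coordDomain e U, ∀ i j,
    ∑ k, tensorCoeff e h i k z * weyl (sprayCoeff e Γ) k j z =
      ∑ k, tensorCoeff e h j k z * weyl (sprayCoeff e Γ) k i z

end Main

end SprayGeometry

/-!
In the coordinates of the chart, put `θᵢ = ∂F/∂yⁱ`, `hᵢⱼ = ∂θⱼ/∂yⁱ`, `Eᵢ = Γ(θᵢ) - ∂F/∂xⁱ` and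
`ωᵢⱼ = Hⱼ(θᵢ) - Hᵢ(θⱼ)`. Everything rests on two identities, valid for every smooth `F`:

* `∂Eᵢ/∂yʲ = (∇h)ᵢⱼ + ωᵢⱼ` (`dy_eulerForm`), the splitting of the left-hand side into its symmetric
  and antisymmetric parts;
* `Γ(ωᵢⱼ) = Hⱼ(Eᵢ) - Hᵢ(Eⱼ) + Γᵏⱼ ωᵢₖ - Γᵏᵢ ωⱼₖ + (hᵢₖ Rᵏⱼ - hⱼₖ Rᵏᵢ)` (`along_horizCurl`), a
  consequence of `[Γ, Hᵢ] = Γᵏᵢ Hₖ + Rᵏᵢ ∂/∂yᵏ`.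

If `E = 0`, the first identity gives `∇h = 0` and `ω = 0`, and then the second one gives the
symmetry of `hᵢₖ Rᵏⱼ`. Since `h` is symmetric and `hᵢⱼ yʲ = 0`, this is the same as the symmetry of
`hᵢₖ Wᵏⱼ` (`sum_mul_weyl`).

Conversely, let `h` satisfy the conditions. For `n ≥ 3` the punctured fibres are simply connected, so
the closed one-forms `hᵢⱼ dyʲ` have primitives `θᵢ` that depend smoothly on `x`
(`exists_fibre_primitive`), and `F = θᵢ yⁱ` is homogeneous with Hessian `h`. As `∇h = 0`, the first
identity shows that `∂ωᵢⱼ/∂yᵏ` is symmetric in `j, k`; being antisymmetric in `i, j`, it vanishes, and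
`ω` is a two-form on the base. Moreover `Eᵢ = ωᵢⱼ yʲ` (`eulerForm_eq_sum_horizCurl`), and now the
second identity says that the contraction of `dω` with every `y ≠ 0` is zero. So `ω` is closed, hence
exact on the contractible set `U` (`exists_primitive_of_closed_two_form`), and adding to `F` the
function `φₖ yᵏ` with `dφ = ω` makes `E` vanish without changing the Hessian
(`exists_lagrangian`).

The choice of the spray in the projective class does not matter, because replacing `Γ` by
`Γ - 2PΔ` changes `Γ(θᵢ)` by `-2P hᵢₖ yᵏ = 0` (`along_sprayCoeff_eq`).
-/

namespace SprayGeometry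

/-! ### Differentiation under the integral sign -/

section ParametricIntegral

variable {X Y : Type} [NormedAddCommGroup X] [NormedSpace ℝ X] [FiniteDimensional ℝ X]
  [NormedAddCommGroup Y] [NormedSpace ℝ Y]

theorem hasFDerivAt_integral_unitInterval {O : Set (X × ℝ)} (hO : IsOpen O) {f : X × ℝ → Y}
    (hf : ContDiffOn ℝ 1 f O) {x₀ : X} (hx : ∀ t ∈ Set.Icc (0 : ℝ) 1, (x₀, t) ∈ O) :
    HasFDerivAt (fun x => ∫ t in (0 : ℝ)..1, f (x, t))
      (∫ t in (0 : ℝ)..1, (fderiv ℝ f (x₀, t)).comp (ContinuousLinearMap.inl ℝ X ℝ)) x₀ := by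
  have := FiniteDimensional.proper_real X
  obtain ⟨u, v, hu, -, hxu, hv, huv⟩ := generalized_tube_lemma (isCompact_singleton (x := x₀))
    (isCompact_Icc (a := (0 : ℝ)) (b := 1)) hO (by rintro ⟨x, t⟩ ⟨rfl, ht⟩; exact hx t ht)
  obtain ⟨r, hr, hru⟩ := Metric.nhds_basis_closedBall.mem_iff.1
    (hu.mem_nhds (hxu (Set.mem_singleton x₀)))
  have hmem : ∀ x ∈ Metric.closedBall x₀ r, ∀ t ∈ Set.Icc (0 : ℝ) 1, (x, t) ∈ O :=
    fun x hx t ht => huv ⟨hru hx, hv ht⟩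
  have hc : ContinuousOn (fun z => (fderiv ℝ f z).comp (ContinuousLinearMap.inl ℝ X ℝ)) O :=
    (hf.continuousOn_fderiv_of_isOpen hO le_rfl).clm_comp continuousOn_const
  obtain ⟨C, hC⟩ := ((isCompact_closedBall x₀ r).prod
    (isCompact_Icc (a := (0 : ℝ)) (b := 1))).exists_bound_of_continuousOn
      (hc.mono fun z hz => hmem z.1 hz.1 z.2 hz.2)
  have hIoc : Set.uIoc (0 : ℝ) 1 ⊆ Set.Icc 0 1 := by
    rw [Set.uIoc_of_le zero_le_one]; exact Set.Ioc_subset_Icc_self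
  have hint : ∀ {Z : Type} [NormedAddCommGroup Z] {g : X × ℝ → Z}, ContinuousOn g O →
      ∀ x ∈ Metric.closedBall x₀ r, ContinuousOn (fun t => g (x, t)) (Set.uIcc (0 : ℝ) 1) := by
    intro Z _ g hg x hx
    rw [Set.uIcc_of_le zero_le_one]
    exact hg.comp (by fun_prop) fun t ht => hmem x hx t ht
  have hx₀ : x₀ ∈ Metric.closedBall x₀ r := Metric.mem_closedBall_self hr.le
  refine intervalIntegral.hasFDerivAt_integral_of_dominated_of_fderiv_le
    (bound := fun _ => C) (F := fun x t => f (x, t))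
    (F' := fun x t => (fderiv ℝ f (x, t)).comp (ContinuousLinearMap.inl ℝ X ℝ))
    (Metric.closedBall_mem_nhds x₀ hr) ?_ ?_ ?_ ?_ (by simp) ?_
  · filter_upwards [Metric.closedBall_mem_nhds x₀ hr] with x hx
    exact ((hint hf.continuousOn x hx).intervalIntegrable).aestronglyMeasurable_restrict_uIoc
  · exact (hint hf.continuousOn x₀ hx₀).intervalIntegrable
  · exact ((hint hc x₀ hx₀).intervalIntegrable).aestronglyMeasurable_restrict_uIoc
  · exact Filter.Eventually.of_forall fun t ht x hx => hC (x, t) ⟨hx, hIoc ht⟩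
  · refine Filter.Eventually.of_forall fun t ht x hx => ?_
    have h1 : HasFDerivAt f (fderiv ℝ f (x, t)) (x, t) :=
      ((hf.contDiffAt (hO.mem_nhds (hmem x hx t (hIoc ht)))).differentiableAt
        one_ne_zero).hasFDerivAt
    exact h1.comp x (hasFDerivAt_prodMk_left x t)

/-- The space `Y` of values is quantified after `k`, because the induction passes to the derivative,
which has values in `X →L[ℝ] Y`. -/
theorem contDiffOn_integral_unitInterval_nat {O : Set (X × ℝ)} (hO : IsOpen O) {W : Set X}
    (hW : IsOpen W) (hWO : ∀ x ∈ W, ∀ t ∈ Set.Icc (0 : ℝ) 1, (x, t) ∈ O) (k : ℕ) :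
    ∀ {Y : Type} [NormedAddCommGroup Y] [NormedSpace ℝ Y] {f : X × ℝ → Y},
      ContDiffOn ℝ ∞ f O → ContDiffOn ℝ k (fun x => ∫ t in (0 : ℝ)..1, f (x, t)) W := by
  induction k with
  | zero =>
    intro Y _ _ f hf
    refine contDiffOn_zero.2 fun x hx => ContinuousAt.continuousWithinAt ?_
    exact (hasFDerivAt_integral_unitInterval hO (hf.of_le (by simp)) (hWO x hx)).continuousAt
  | succ k ih =>
    intro Y _ _ f hf
    have hd : ∀ x ∈ W, HasFDerivAt (fun x => ∫ t in (0 : ℝ)..1, f (x, t)) _ x := fun x hx =>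
      hasFDerivAt_integral_unitInterval hO (hf.of_le (by simp)) (hWO x hx)
    push_cast
    refine (contDiffOn_succ_iff_fderiv_of_isOpen hW).2
      ⟨fun x hx => (hd x hx).differentiableAt.differentiableWithinAt, by simp, ?_⟩
    refine ContDiffOn.congr (ih (Y := X →L[ℝ] Y)
      (f := fun z => (fderiv ℝ f z).comp (ContinuousLinearMap.inl ℝ X ℝ)) ?_)
      fun x hx => (hd x hx).fderiv
    exact (hf.fderiv_of_isOpen hO (by simp)).clm_comp contDiffOn_const

theorem contDiffOn_integral_unitInterval {O : Set (X × ℝ)} (hO : IsOpen O) {W : Set X}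
    (hW : IsOpen W) (hWO : ∀ x ∈ W, ∀ t ∈ Set.Icc (0 : ℝ) 1, (x, t) ∈ O) {f : X × ℝ → Y}
    (hf : ContDiffOn ℝ ∞ f O) :
    ContDiffOn ℝ ∞ (fun x => ∫ t in (0 : ℝ)..1, f (x, t)) W :=
  contDiffOn_infty.2 fun k => contDiffOn_integral_unitInterval_nat hO hW hWO k hf

end ParametricIntegral

/-! ### Closed one-forms on the punctured fibres -/

section FibrePrimitive

variable {X : Type} [NormedAddCommGroup X] [NormedSpace ℝ X]

/-- A form of the tube lemma. -/
theorem isOpen_setOf_forall_mem_Icc {Z : Type} [TopologicalSpace Z] {O : Set (Z × ℝ)}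
    (hO : IsOpen O) : IsOpen {x | ∀ t ∈ Set.Icc (0 : ℝ) 1, (x, t) ∈ O} := by
  rw [isOpen_iff_mem_nhds]
  intro x hx
  obtain ⟨u, v, hu, -, hxu, hv, huv⟩ := generalized_tube_lemma (isCompact_singleton (x := x))
    (isCompact_Icc (a := (0 : ℝ)) (b := 1)) hO (by rintro ⟨y, t⟩ ⟨rfl, ht⟩; exact hx t ht)
  filter_upwards [hu.mem_nhds (hxu (Set.mem_singleton x))] with y hy t ht
  exact huv ⟨hy, hv ht⟩

/-- The points `(x, y)` over `V` such that the segment from `a` to `y` avoids the origin. -/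
def starRegion (V : Set X) (a : X) : Set (X × X) :=
  {z | ∀ t ∈ Set.Icc (0 : ℝ) 1, z.1 ∈ V ∧ a + t • (z.2 - a) ≠ 0}

/-- The integral of the fibre one-form `α` along the segment from `(x, a)` to `(x, y)`. -/
noncomputable def segmentPrimitive (α : X × X → X →L[ℝ] ℝ) (a : X) (z : X × X) : ℝ :=
  ∫ t in (0 : ℝ)..1, α (z.1, a + t • (z.2 - a)) (z.2 - a)

theorem isOpen_segmentDomain {V : Set X} (hV : IsOpen V) (a : X) :
    IsOpen {w : (X × X) × ℝ | w.1.1 ∈ V ∧ a + w.2 • (w.1.2 - a) ≠ 0} :=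
  (hV.preimage (by fun_prop)).inter
    (isOpen_compl_singleton (x := (0 : X)) |>.preimage
      (f := fun w : (X × X) × ℝ => a + w.2 • (w.1.2 - a)) (by fun_prop))

theorem isOpen_starRegion {V : Set X} (hV : IsOpen V) (a : X) : IsOpen (starRegion V a) :=
  isOpen_setOf_forall_mem_Icc (isOpen_segmentDomain hV a)

theorem contDiffOn_segmentIntegrand {V : Set X} {α : X × X → X →L[ℝ] ℝ}
    (hα : ContDiffOn ℝ ∞ α (V ×ˢ {0}ᶜ)) (a : X) :
    ContDiffOn ℝ ∞ (fun w : (X × X) × ℝ => α (w.1.1, a + w.2 • (w.1.2 - a)) (w.1.2 - a))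
      {w | w.1.1 ∈ V ∧ a + w.2 • (w.1.2 - a) ≠ 0} := by
  refine ContDiffOn.clm_apply (hα.comp (ContDiff.contDiffOn (by fun_prop)) fun w hw => ⟨hw.1, hw.2⟩)
    (ContDiff.contDiffOn (by fun_prop))

theorem contDiffOn_segmentPrimitive [FiniteDimensional ℝ X] {V : Set X} (hV : IsOpen V) {α : X × X → X →L[ℝ] ℝ}
    (hα : ContDiffOn ℝ ∞ α (V ×ˢ {0}ᶜ)) (a : X) :
    ContDiffOn ℝ ∞ (segmentPrimitive α a) (starRegion V a) :=
  contDiffOn_integral_unitInterval (isOpen_segmentDomain hV a) (isOpen_starRegion hV a)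
    (fun _ hz t ht => hz t ht) (contDiffOn_segmentIntegrand hα a)

theorem fderiv_segmentPrimitive [FiniteDimensional ℝ X] {V : Set X} (hV : IsOpen V) {α : X × X → X →L[ℝ] ℝ}
    (hα : ContDiffOn ℝ ∞ α (V ×ˢ {0}ᶜ))
    (hclosed : ∀ z ∈ V ×ˢ ({0}ᶜ : Set X), ∀ u v,
      fderiv ℝ α z (0, u) v = fderiv ℝ α z (0, v) u)
    (a : X) {z : X × X} (hz : z ∈ starRegion V a) (u : X) :
    fderiv ℝ (segmentPrimitive α a) z (0, u) = α z u := by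
  have hopen : IsOpen (V ×ˢ ({0}ᶜ : Set X)) := hV.prod isOpen_compl_singleton
  have hO := isOpen_segmentDomain hV a
  have hf := contDiffOn_segmentIntegrand hα a
  have hpt : ∀ t ∈ Set.Icc (0 : ℝ) 1, (z.1, a + t • (z.2 - a)) ∈ V ×ˢ ({0}ᶜ : Set X) :=
    fun t ht => hz t ht
  have hαd : ∀ t ∈ Set.Icc (0 : ℝ) 1, HasFDerivAt α
      (fderiv ℝ α (z.1, a + t • (z.2 - a))) (z.1, a + t • (z.2 - a)) := fun t ht =>
    ((hα.contDiffAt (hopen.mem_nhds (hpt t ht))).differentiableAt (by simp)).hasFDerivAt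
  have hc : ContinuousOn (fun t : ℝ => (fderiv ℝ
      (fun w : (X × X) × ℝ => α (w.1.1, a + w.2 • (w.1.2 - a)) (w.1.2 - a)) (z, t)).comp
      (ContinuousLinearMap.inl ℝ (X × X) ℝ)) (Set.uIcc 0 1) := by
    rw [Set.uIcc_of_le zero_le_one]
    exact ((hf.continuousOn_fderiv_of_isOpen hO (by simp)).comp (by fun_prop)
      fun t ht => hz t ht).clm_comp continuousOn_const
  have key := (hasFDerivAt_integral_unitInterval hO (hf.of_le (by simp)) hz).fderiv
  unfold segmentPrimitive
  rw [key, ContinuousLinearMap.intervalIntegral_apply hc.intervalIntegrable]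
  -- the integrand is the derivative of `t ↦ t α(x, a + t (y - a)) u`
  have hderiv : ∀ t ∈ Set.uIcc (0 : ℝ) 1, HasDerivAt
      (fun t : ℝ => t * α (z.1, a + t • (z.2 - a)) u)
      ((fderiv ℝ (fun w : (X × X) × ℝ => α (w.1.1, a + w.2 • (w.1.2 - a)) (w.1.2 - a))
        (z, t)).comp (ContinuousLinearMap.inl ℝ (X × X) ℝ) (0, u)) t := by
    intro t ht
    rw [Set.uIcc_of_le zero_le_one] at ht
    have h1 : HasDerivAt (fun t : ℝ => (z.1, a + t • (z.2 - a))) ((0 : X), z.2 - a) t := by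
      have := ((hasDerivAt_id t).smul_const (z.2 - a)).const_add a
      simpa using (hasDerivAt_const t z.1).prodMk this
    have h2 : HasDerivAt (fun t : ℝ => α (z.1, a + t • (z.2 - a)))
        (fderiv ℝ α (z.1, a + t • (z.2 - a)) (0, z.2 - a)) t :=
      (hαd t ht).comp_hasDerivAt t h1
    have h3 : HasDerivAt (fun t : ℝ => t * α (z.1, a + t • (z.2 - a)) u)
        (1 * α (z.1, a + t • (z.2 - a)) u +
          t * fderiv ℝ α (z.1, a + t • (z.2 - a)) (0, z.2 - a) u) t := by
      have h2' : HasDerivAt (fun t : ℝ => α (z.1, a + t • (z.2 - a)) u)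
          (fderiv ℝ α (z.1, a + t • (z.2 - a)) (0, z.2 - a) u) t := by
        simpa using h2.clm_apply (hasDerivAt_const t u)
      exact (hasDerivAt_id t).fun_mul h2'
    have h4 : HasFDerivAt (fun w : (X × X) × ℝ => (w.1.1, a + w.2 • (w.1.2 - a)))
        ((((ContinuousLinearMap.fst ℝ X X).comp (ContinuousLinearMap.fst ℝ (X × X) ℝ))).prod
          (t • ((ContinuousLinearMap.snd ℝ X X).comp (ContinuousLinearMap.fst ℝ (X × X) ℝ)) +
            (ContinuousLinearMap.snd ℝ (X × X) ℝ).smulRight (z.2 - a))) (z, t) := by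
      refine HasFDerivAt.prodMk (ContinuousLinearMap.hasFDerivAt
        ((ContinuousLinearMap.fst ℝ X X).comp (ContinuousLinearMap.fst ℝ (X × X) ℝ))) ?_
      have e1 : HasFDerivAt (fun w : (X × X) × ℝ => w.1.2 - a)
          ((ContinuousLinearMap.snd ℝ X X).comp (ContinuousLinearMap.fst ℝ (X × X) ℝ)) (z, t) :=
        (ContinuousLinearMap.hasFDerivAt
          ((ContinuousLinearMap.snd ℝ X X).comp (ContinuousLinearMap.fst ℝ (X × X) ℝ))).sub_const a
      have e2 := (ContinuousLinearMap.hasFDerivAt (x := (z, t))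
        (ContinuousLinearMap.snd ℝ (X × X) ℝ)).fun_smul e1
      exact e2.const_add a
    have h5 := (HasFDerivAt.comp (z, t) (hαd t ht) h4).clm_apply
      ((ContinuousLinearMap.hasFDerivAt
        ((ContinuousLinearMap.snd ℝ X X).comp (ContinuousLinearMap.fst ℝ (X × X) ℝ))
          (x := (z, t))).sub_const a)
    have h6 : fderiv ℝ (fun w : (X × X) × ℝ => α (w.1.1, a + w.2 • (w.1.2 - a)) (w.1.2 - a))
        (z, t) = _ := h5.fderiv
    rw [h6]
    convert h3 using 1
    have h7 : fderiv ℝ α (z.1, a + t • (z.2 - a)) (0, t • u) (z.2 - a) =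
        t * fderiv ℝ α (z.1, a + t • (z.2 - a)) (0, z.2 - a) u := by
      rw [hclosed _ (hpt t ht), map_smul, smul_eq_mul]
    rw [map_sub] at h7
    simp [h7, add_comm]
  have hc2 : ContinuousOn (fun t : ℝ => (fderiv ℝ
      (fun w : (X × X) × ℝ => α (w.1.1, a + w.2 • (w.1.2 - a)) (w.1.2 - a)) (z, t)).comp
      (ContinuousLinearMap.inl ℝ (X × X) ℝ) (0, u)) (Set.uIcc 0 1) :=
    hc.clm_apply continuousOn_const
  rw [intervalIntegral.integral_eq_sub_of_hasDerivAt hderiv hc2.intervalIntegrable]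
  simp

/-- The segment from `a` to `y` meets the origin only if `y` lies on the opposite ray, so the two
star-shaped regions of `a` and `-a` cover the punctured fibre. -/
theorem mem_starRegion_or {V : Set X} {a : X} (ha : a ≠ 0) {z : X × X}
    (hz : z ∈ V ×ˢ ({0}ᶜ : Set X)) : z ∈ starRegion V a ∨ z ∈ starRegion V (-a) := by
  by_contra! h
  simp only [starRegion, Set.mem_ofPred_eq, not_forall, not_and, ne_eq, not_not, exists_prop] at h
  obtain ⟨⟨t, ht, h1⟩, s, hs, h2⟩ := h
  have h1 := h1 hz.1
  have h2 := h2 hz.1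
  have hy : z.2 ≠ 0 := hz.2
  -- eliminate `y` between `t y = -(1 - t) a` and `s y = (1 - s) a`
  have e1 : t • z.2 = (t - 1) • a := by
    rw [← sub_eq_zero, ← h1]; module
  have e2 : s • z.2 = (1 - s) • a := by
    rw [← sub_eq_zero, ← h2]; module
  have e3 : (s * (t - 1) - t * (1 - s)) • a = 0 := by
    rw [sub_smul, mul_smul, mul_smul, ← e1, ← e2]; module
  have e4 := (smul_eq_zero.1 e3).resolve_right ha
  have ht0 : t ≠ 0 := by
    rintro rfl
    simp at e1; exact ha e1
  have hs0 : s ≠ 0 := by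
    rintro rfl
    simp at e2; exact ha e2.symm
  have ht1 : t ≠ 1 := by
    rintro rfl
    simp at e1; exact hy e1
  have h3 : 0 < s * (1 - t) := mul_pos (lt_of_le_of_ne hs.1 hs0.symm)
    (sub_pos.2 (lt_of_le_of_ne ht.2 ht1))
  nlinarith [mul_nonneg ht.1 (sub_nonneg.2 hs.2)]

/-- On a vector space of dimension at least three, a smooth family (with parameters in `V`) of
closed one-forms on the punctured space has a smooth family of primitives. The primitives on the
two star-shaped regions of `a` and `-a` differ by a constant on each fibre, because the complement
of the line through `a` is connected. -/
theorem exists_fibre_primitive [FiniteDimensional ℝ X] (hdim : 3 ≤ Module.finrank ℝ X) {V : Set X} (hV : IsOpen V)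
    {α : X × X → X →L[ℝ] ℝ} (hα : ContDiffOn ℝ ∞ α (V ×ˢ {0}ᶜ))
    (hclosed : ∀ z ∈ V ×ˢ ({0}ᶜ : Set X), ∀ u v,
      fderiv ℝ α z (0, u) v = fderiv ℝ α z (0, v) u) :
    ∃ θ : X × X → ℝ, ContDiffOn ℝ ∞ θ (V ×ˢ {0}ᶜ) ∧
      ∀ z ∈ V ×ˢ ({0}ᶜ : Set X), ∀ u, fderiv ℝ θ z (0, u) = α z u := by
  have : Nontrivial X := Module.nontrivial_of_finrank_pos (R := ℝ) (by omega)
  obtain ⟨a, ha⟩ := exists_ne (0 : X)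
  set L : Submodule ℝ X := ℝ ∙ a
  have hL : IsConnected ((L : Set X)ᶜ) := by
    apply isConnected_compl_of_one_lt_codim
    have h1 := L.finrank_quotient_add_finrank
    have h2 : Module.finrank ℝ L = 1 := finrank_span_singleton ha
    rw [← Module.finrank_eq_rank]
    exact_mod_cast (by omega : 1 < Module.finrank ℝ (X ⧸ L))
  have hLopen : IsOpen ((L : Set X)ᶜ) := L.closed_of_finiteDimensional.isOpen_compl
  obtain ⟨b, hb⟩ := hL.nonempty
  have hLW : ∀ c : ℝ, c ≠ 0 → ∀ x ∈ V, ∀ y ∈ (L : Set X)ᶜ, (x, y) ∈ starRegion V (c • a) := by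
    intro c hc x hx y hy t ht
    refine ⟨hx, fun h => ?_⟩
    by_cases h0 : t = 0
    · subst h0
      simp [hc, ha] at h
    · apply hy
      have : y = (t⁻¹ * ((t - 1) * c)) • a := by
        rw [mul_smul, eq_inv_smul_iff₀ h0, ← sub_eq_zero, ← h]; module
      rw [this]
      exact L.smul_mem _ (Submodule.mem_span_singleton_self a)
  have hp : ∀ x ∈ V, ∀ y ∈ (L : Set X)ᶜ, (x, y) ∈ starRegion V a := fun x hx y hy => by
    simpa using hLW 1 one_ne_zero x hx y hy
  have hm : ∀ x ∈ V, ∀ y ∈ (L : Set X)ᶜ, (x, y) ∈ starRegion V (-a) := fun x hx y hy => by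
    simpa using hLW (-1) (by norm_num) x hx y hy
  have hinter : ∀ z, z ∈ starRegion V a → z ∈ starRegion V (-a) → z.2 ∈ (L : Set X)ᶜ := by
    intro z h1 h2 hzL
    obtain ⟨s, hs⟩ := Submodule.mem_span_singleton.1 hzL
    have hz0 : z.2 ≠ 0 := by simpa using (h1 1 (by simp)).2
    rcases lt_trichotomy s 0 with h | h | h
    · have h3 : (0 : ℝ) < 1 - s := by linarith
      refine (h1 (1 - s)⁻¹ ⟨by positivity, inv_le_one_of_one_le₀ (by linarith)⟩).2 ?_
      rw [← hs, show s • a - a = (-(1 - s)) • a by module, smul_smul, mul_neg,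
        inv_mul_cancel₀ h3.ne']
      module
    · exact hz0 (by rw [← hs, h, zero_smul])
    · have h3 : (0 : ℝ) < 1 + s := by linarith
      refine (h2 (1 + s)⁻¹ ⟨by positivity, inv_le_one_of_one_le₀ (by linarith)⟩).2 ?_
      rw [← hs, show s • a - -a = (1 + s) • a by module, smul_smul, inv_mul_cancel₀ h3.ne']
      module
  have ho₁ := isOpen_starRegion hV a
  have ho₂ := isOpen_starRegion hV (-a)
  have hs₁ := contDiffOn_segmentPrimitive hV hα a
  have hs₂ := contDiffOn_segmentPrimitive hV hα (-a)
  have hd₁ := fun z hz u => fderiv_segmentPrimitive hV hα hclosed a (z := z) hz u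
  have hd₂ := fun z hz u => fderiv_segmentPrimitive hV hα hclosed (-a) (z := z) hz u
  set θ₁ := segmentPrimitive α a
  set θ₂ := segmentPrimitive α (-a)
  have hD₁ : ∀ z ∈ starRegion V a, DifferentiableAt ℝ θ₁ z := fun z hz =>
    (hs₁.contDiffAt (ho₁.mem_nhds hz)).differentiableAt (by simp)
  have hD₂ : ∀ z ∈ starRegion V (-a), DifferentiableAt ℝ θ₂ z := fun z hz =>
    (hs₂.contDiffAt (ho₂.mem_nhds hz)).differentiableAt (by simp)
  -- the difference of the two primitives, a function of the parameter alone
  set c : X → ℝ := fun x => θ₁ (x, b) - θ₂ (x, b)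
  have hc : ContDiffOn ℝ ∞ c V :=
    (hs₁.comp (ContDiff.contDiffOn (by fun_prop)) fun x hx => hp x hx b hb).sub
      (hs₂.comp (ContDiff.contDiffOn (by fun_prop)) fun x hx => hm x hx b hb)
  have hglue : ∀ z, z ∈ starRegion V a → z ∈ starRegion V (-a) → θ₁ z = θ₂ z + c z.1 := by
    intro z h1 h2
    have hx : z.1 ∈ V := (h1 0 (by simp)).1
    have key := hLopen.is_const_of_fderiv_eq_zero hL.isPreconnected
      (f := fun y => θ₁ (z.1, y) - θ₂ (z.1, y)) (𝕜 := ℝ) ?_ ?_ (hinter z h1 h2) hb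
    · simp only [c]
      linarith
    · intro y hy
      refine DifferentiableAt.differentiableWithinAt (DifferentiableAt.sub ?_ ?_)
      · exact (hD₁ _ (hp _ hx y hy)).comp y (by fun_prop)
      · exact (hD₂ _ (hm _ hx y hy)).comp y (by fun_prop)
    · intro y hy
      have e1 := (hD₁ _ (hp _ hx y hy)).hasFDerivAt.comp y (hasFDerivAt_prodMk_right z.1 y)
      have e2 := (hD₂ _ (hm _ hx y hy)).hasFDerivAt.comp y (hasFDerivAt_prodMk_right z.1 y)
      refine (e1.sub e2).fderiv.trans ?_
      ext u
      simp [hd₁ _ (hp _ hx y hy), hd₂ _ (hm _ hx y hy)]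
  classical
  set θ : X × X → ℝ := fun z => if z ∈ starRegion V a then θ₁ z else θ₂ z + c z.1
  have hθ₁ : ∀ z ∈ starRegion V a, θ =ᶠ[nhds z] θ₁ := fun z hz => by
    filter_upwards [ho₁.mem_nhds hz] with w hw
    simp [θ, hw]
  have hθ₂ : ∀ z ∈ starRegion V (-a), θ =ᶠ[nhds z] fun w => θ₂ w + c w.1 := fun z hz => by
    filter_upwards [ho₂.mem_nhds hz] with w hw
    by_cases h : w ∈ starRegion V a
    · simp [θ, h, hglue w h hw]
    · simp [θ, h]
  have hca : ∀ z : X × X, z.1 ∈ V → ContDiffAt ℝ ∞ (fun w : X × X => c w.1) z := fun z hz =>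
    (hc.contDiffAt (hV.mem_nhds hz)).comp z (by fun_prop)
  refine ⟨θ, fun z hz => ContDiffAt.contDiffWithinAt ?_, fun z hz u => ?_⟩
  · rcases mem_starRegion_or ha hz with h | h
    · exact (hs₁.contDiffAt (ho₁.mem_nhds h)).congr_of_eventuallyEq (hθ₁ z h)
    · exact ((hs₂.contDiffAt (ho₂.mem_nhds h)).add (hca z hz.1)).congr_of_eventuallyEq (hθ₂ z h)
  · rcases mem_starRegion_or ha hz with h | h
    · rw [(hθ₁ z h).fderiv_eq, hd₁ z h]
    · have e1 : HasFDerivAt c (fderiv ℝ c z.1) z.1 :=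
        ((hc.contDiffAt (hV.mem_nhds hz.1)).differentiableAt (by simp)).hasFDerivAt
      have e2 := (hD₂ z h).hasFDerivAt.add (e1.comp z hasFDerivAt_fst)
      rw [(hθ₂ z h).fderiv_eq, show fderiv ℝ (fun w => θ₂ w + c w.1) z = _ from e2.fderiv]
      simp [hd₂ z h]

end FibrePrimitive

/-! ### Closed two-forms on contractible open sets -/

section TwoForms

variable {X : Type} [NormedAddCommGroup X] [NormedSpace ℝ X]

theorem convex_setOf_imp_eq (p : Prop) (a : X) : Convex ℝ {y | p → y = a} := by
  by_cases hp : p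
  · simp [hp]
  · simp only [hp, false_imp_iff]
    exact convex_univ

/-- A contractible open set has a smooth contraction. The values allowed at `(x, t)` form a convex
set: a ball around the value of a continuous contraction, contained in `V`, cut down to a point
for `t` near the ends; a smooth selection exists by a partition of unity. -/
theorem exists_smooth_contraction [FiniteDimensional ℝ X] {V : Set X} (hV : IsOpen V)
    [ContractibleSpace V] :
    ∃ (K : X × ℝ → X) (c : X), ContDiffOn ℝ ∞ K (V ×ˢ Set.univ) ∧
      (∀ z ∈ V ×ˢ (Set.univ : Set ℝ), K z ∈ V) ∧ (∀ x ∈ V, K (x, 0) = x) ∧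
      ∀ x ∈ V, K (x, 1) = c := by
  have := FiniteDimensional.proper_real X
  obtain ⟨c, ⟨H⟩⟩ := id_nullhomotopic V
  have hO : IsOpen (V ×ˢ (Set.univ : Set ℝ)) := hV.prod isOpen_univ
  let O : TopologicalSpace.Opens (X × ℝ) := ⟨V ×ˢ Set.univ, hO⟩
  -- the continuous contraction, slowed down so that it is constant in `t` near both ends
  let h : O → X := fun p => (H (Set.projIcc 0 1 zero_le_one (3 * p.1.2 - 1), ⟨p.1.1, p.2.1⟩) : V)
  have hh : Continuous h := by
    refine continuous_subtype_val.comp (H.continuous.comp (Continuous.prodMk ?_ ?_))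
    · exact continuous_projIcc.comp (by fun_prop)
    · exact Continuous.subtype_mk (by fun_prop) _
  have hhV : ∀ p, h p ∈ V := fun p => (H _).2
  have hh0 : ∀ p : O, p.1.2 ≤ 1 / 3 → h p = p.1.1 := fun p hp => by
    simp only [h]
    rw [Set.projIcc_of_le_left _ (by linarith)]
    exact congrArg Subtype.val (H.apply_zero _)
  have hh1 : ∀ p : O, 2 / 3 ≤ p.1.2 → h p = c := fun p hp => by
    simp only [h]
    rw [Set.projIcc_of_right_le _ (by linarith)]
    exact congrArg Subtype.val (H.apply_one _)
  let B : O → Set X := fun p => Metric.eball (h p) (Metric.infEDist (h p) Vᶜ)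
  have hself : ∀ p, h p ∈ B p := fun p => by
    refine Metric.mem_eball_self ?_
    rw [pos_iff_ne_zero, Ne, ← Metric.mem_closure_iff_infEDist_zero,
      hV.isClosed_compl.closure_eq]
    exact fun hc => hc (hhV p)
  let T : O → Set X := fun p =>
    {y | y ∈ B p ∧ (p.1.2 ≤ 1 / 4 → y = p.1.1) ∧ (3 / 4 ≤ p.1.2 → y = c)}
  have hT : ∀ p, Convex ℝ (T p) := by
    intro p
    refine (convex_eball _ _).inter (Convex.inter (s := {y | p.1.2 ≤ 1 / 4 → y = p.1.1})
      (t := {y | 3 / 4 ≤ p.1.2 → y = (c : X)}) ?_ ?_)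
    · exact convex_setOf_imp_eq _ _
    · exact convex_setOf_imp_eq _ _
  have : LocallyCompactSpace O := hO.locallyCompactSpace
  have : SecondCountableTopology X := secondCountable_of_proper
  have : SecondCountableTopology O := TopologicalSpace.Subtype.secondCountableTopology _
  have : SigmaCompactSpace O := sigmaCompactSpace_of_locallyCompact_secondCountable
  have htime : Continuous fun p : O => p.1.2 := by fun_prop
  obtain ⟨g, hg⟩ := exists_contMDiffMap_forall_mem_convex_of_local 𝓘(ℝ, X × ℝ) (n := ⊤) hT (by
    intro p
    rcases lt_or_ge p.1.2 (1 / 3) with h1 | h1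
    · refine ⟨{q | q.1.2 < 1 / 3}, (isOpen_lt htime continuous_const).mem_nhds h1,
        fun q => q.1.1, ?_, fun q hq => ⟨?_, fun _ => rfl, fun hq' => ?_⟩⟩
      · refine ContMDiff.contMDiffOn ?_
        exact (contDiff_fst.contMDiff).comp contMDiff_subtype_val
      · have hq' : q.1.2 < 1 / 3 := hq
        change q.1.1 ∈ B q
        rw [← hh0 q hq'.le]; exact hself q
      · have hq'' : q.1.2 < 1 / 3 := hq
        linarith
    rcases lt_or_ge (2 / 3) p.1.2 with h2 | h2
    · refine ⟨{q | 2 / 3 < q.1.2}, (isOpen_lt continuous_const htime).mem_nhds h2,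
        fun q => c, contMDiffOn_const, fun q hq => ⟨?_, fun hq' => ?_, fun _ => rfl⟩⟩
      · have hq' : 2 / 3 < q.1.2 := hq
        change (c : X) ∈ B q
        rw [← hh1 q hq'.le]; exact hself q
      · have hq'' : 2 / 3 < q.1.2 := hq
        linarith
    · have hB : ∀ᶠ q in nhds p, h p ∈ B q := by
        have hlt : IsOpen {q | edist (h p) (h q) < Metric.infEDist (h q) Vᶜ} :=
          isOpen_lt (by fun_prop) (Metric.continuous_infEDist.comp hh)
        exact hlt.mem_nhds (hself p)
      refine ⟨_, hB.and ((htime.continuousAt.eventually (lt_mem_nhds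
        (by linarith : (1 / 4 : ℝ) < p.1.2))).and (htime.continuousAt.eventually
          (gt_mem_nhds (by linarith : p.1.2 < (3 / 4 : ℝ))))), fun _ => h p, contMDiffOn_const, ?_⟩
      rintro q ⟨hq1, hq2, hq3⟩
      exact ⟨hq1, fun h => absurd h (not_le.2 hq2), fun h => absurd h (not_le.2 hq3)⟩)
  refine ⟨Function.extend Subtype.val g 0, c, ?_, ?_, ?_, ?_⟩
  · intro z hz
    have h1 : ContMDiffAt 𝓘(ℝ, X × ℝ) 𝓘(ℝ, X) ∞
        (Function.extend (Subtype.val : O → X × ℝ) g 0) ((⟨z, hz⟩ : O) : X × ℝ) := by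
      rw [← contMDiffAt_subtype_iff]
      exact (g.contMDiff.contMDiffAt (x := ⟨z, hz⟩)).congr_of_eventuallyEq
        (Filter.Eventually.of_forall fun q => Subtype.val_injective.extend_apply g 0 q)
    exact h1.contDiffAt.contDiffWithinAt
  · intro z hz
    have e := Subtype.val_injective.extend_apply g 0 (⟨z, hz⟩ : O)
    change Function.extend Subtype.val g 0 z = _ at e
    rw [e]
    by_contra hnot
    have h1 := (hg ⟨z, hz⟩).1
    rw [Metric.mem_eball, edist_comm] at h1
    exact absurd h1 (not_lt.2 (Metric.infEDist_le_edist_of_mem hnot))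
  · intro x hx
    have e := Subtype.val_injective.extend_apply g 0 (⟨(x, 0), hx, trivial⟩ : O)
    exact e.trans ((hg ⟨(x, 0), hx, trivial⟩).2.1 (by norm_num))
  · intro x hx
    have e := Subtype.val_injective.extend_apply g 0 (⟨(x, 1), hx, trivial⟩ : O)
    exact e.trans ((hg ⟨(x, 1), hx, trivial⟩).2.2 (by norm_num))

set_option synthInstance.maxHeartbeats 200000 in
/-- The components of the pullback of the two-form `β` by `K` are differentiable, with the derivative
given by the product rule. -/
theorem fderiv_pullback_apply {V : Set X} (hV : IsOpen V) {β : X → X →L[ℝ] X →L[ℝ] ℝ}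
    (hβ : ContDiffOn ℝ ∞ β V) {O : Set (X × ℝ)} (hO : IsOpen O) {K : X × ℝ → X}
    (hK : ContDiffOn ℝ ∞ K O) (hKV : ∀ z ∈ O, K z ∈ V) {z : X × ℝ} (hz : z ∈ O)
    (a b p : X × ℝ) :
    DifferentiableAt ℝ (fun w => β (K w) (fderiv ℝ K w a) (fderiv ℝ K w b)) z ∧
    fderiv ℝ (fun w => β (K w) (fderiv ℝ K w a) (fderiv ℝ K w b)) z p =
      fderiv ℝ β (K z) (fderiv ℝ K z p) (fderiv ℝ K z a) (fderiv ℝ K z b) +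
        β (K z) (fderiv ℝ (fderiv ℝ K) z p a) (fderiv ℝ K z b) +
        β (K z) (fderiv ℝ K z a) (fderiv ℝ (fderiv ℝ K) z p b) := by
  have h1 : HasFDerivAt K (fderiv ℝ K z) z :=
    ((hK.contDiffAt (hO.mem_nhds hz)).differentiableAt (by simp)).hasFDerivAt
  have h2 : HasFDerivAt (fderiv ℝ K) (fderiv ℝ (fderiv ℝ K) z) z :=
    (((hK.fderiv_of_isOpen (m := ∞) hO (by simp)).contDiffAt (hO.mem_nhds hz)).differentiableAt
      (by simp)).hasFDerivAt
  have h3 : HasFDerivAt β (fderiv ℝ β (K z)) (K z) :=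
    ((hβ.contDiffAt (hV.mem_nhds (hKV z hz))).differentiableAt (by simp)).hasFDerivAt
  have h4 : HasFDerivAt (fun w => β (K w)) ((fderiv ℝ β (K z)).comp (fderiv ℝ K z)) z :=
    HasFDerivAt.comp (G := X →L[ℝ] X →L[ℝ] ℝ) (g := β) z h3 h1
  have h5 := (h4.clm_apply (h2.clm_apply (hasFDerivAt_const a z))).clm_apply
    (h2.clm_apply (hasFDerivAt_const b z))
  refine ⟨h5.differentiableAt, ?_⟩
  rw [h5.fderiv]
  simp
  ring

set_option synthInstance.maxHeartbeats 200000 in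
/-- A closed two-form on a contractible open set is exact: up to sign, the primitive is the integral
over `t ∈ [0, 1]` of the contraction of `∂/∂t` with the pullback of the form by a smooth
contraction `K`. -/
theorem exists_primitive_of_closed_two_form [FiniteDimensional ℝ X] {V : Set X} (hV : IsOpen V)
    [ContractibleSpace V] {β : X → X →L[ℝ] X →L[ℝ] ℝ} (hβ : ContDiffOn ℝ ∞ β V)
    (halt : ∀ x ∈ V, ∀ u v, β x u v = -β x v u)
    (hclosed : ∀ x ∈ V, ∀ u v w,
      fderiv ℝ β x u v w + fderiv ℝ β x v w u + fderiv ℝ β x w u v = 0) :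
    ∃ φ : X → X →L[ℝ] ℝ, ContDiffOn ℝ ∞ φ V ∧
      ∀ x ∈ V, ∀ u v, fderiv ℝ φ x u v - fderiv ℝ φ x v u = β x u v := by
  obtain ⟨K, c, hK, hKV, hK0, hK1⟩ := exists_smooth_contraction hV
  have hO : IsOpen (V ×ˢ (Set.univ : Set ℝ)) := hV.prod isOpen_univ
  have hK' : ContDiffOn ℝ ∞ (fderiv ℝ K) (V ×ˢ Set.univ) := hK.fderiv_of_isOpen hO (by simp)
  set Ω : X × ℝ → X →L[ℝ] ℝ := fun w =>
    (β (K w) (fderiv ℝ K w (0, 1))).comp ((fderiv ℝ K w).comp (ContinuousLinearMap.inl ℝ X ℝ))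
  have hΩ : ContDiffOn ℝ ∞ Ω (V ×ˢ Set.univ) :=
    ((hβ.comp hK hKV).clm_apply (hK'.clm_apply contDiffOn_const)).clm_comp
      (hK'.clm_comp contDiffOn_const)
  have hmem : ∀ x ∈ V, ∀ t ∈ Set.Icc (0 : ℝ) 1, (x, t) ∈ V ×ˢ (Set.univ : Set ℝ) :=
    fun x hx t _ => ⟨hx, trivial⟩
  have hΩ' : ∀ z ∈ V ×ˢ (Set.univ : Set ℝ), ∀ p v, fderiv ℝ Ω z p v =
      fderiv ℝ (fun w => β (K w) (fderiv ℝ K w (0, 1)) (fderiv ℝ K w (v, 0))) z p := by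
    intro z hz p v
    have h1 : HasFDerivAt Ω (fderiv ℝ Ω z) z :=
      ((hΩ.contDiffAt (hO.mem_nhds hz)).differentiableAt (by simp)).hasFDerivAt
    have h2 := (h1.clm_apply (hasFDerivAt_const v z)).fderiv
    have h3 : (fun w => β (K w) (fderiv ℝ K w (0, 1)) (fderiv ℝ K w (v, 0))) =
        fun w => Ω w v := by
      ext w; simp [Ω]
    rw [h3, h2]
    simp
  refine ⟨fun x => -∫ t in (0 : ℝ)..1, Ω (x, t),
    (contDiffOn_integral_unitInterval hO hV hmem hΩ).neg, fun x hx u v => ?_⟩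
  have hd := (hasFDerivAt_integral_unitInterval hO (hΩ.of_le (by simp)) (hmem x hx)).fun_neg.fderiv
  have hc : Continuous fun t : ℝ =>
      (fderiv ℝ Ω (x, t)).comp (ContinuousLinearMap.inl ℝ X ℝ) := by
    refine Continuous.clm_comp ?_ continuous_const
    exact (hΩ.continuousOn_fderiv_of_isOpen hO (by simp)).comp_continuous (by fun_prop)
      fun t => ⟨hx, trivial⟩
  have hcu : ∀ u, Continuous fun t : ℝ =>
      (fderiv ℝ Ω (x, t)).comp (ContinuousLinearMap.inl ℝ X ℝ) u := fun u =>
    hc.clm_apply continuous_const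
  have happ : ∀ u v, fderiv ℝ (fun x => -∫ t in (0 : ℝ)..1, Ω (x, t)) x u v =
      -∫ t in (0 : ℝ)..1, fderiv ℝ Ω (x, t) (u, 0) v := by
    intro u v
    rw [hd]
    simp only [neg_apply]
    rw [ContinuousLinearMap.intervalIntegral_apply (hc.intervalIntegrable _ _),
      ContinuousLinearMap.intervalIntegral_apply ((hcu u).intervalIntegrable _ _)]
    simp
  have hci : ∀ u v, IntervalIntegrable (fun t : ℝ => fderiv ℝ Ω (x, t) (u, 0) v)
      MeasureTheory.volume 0 1 := fun u v => by
    simpa using ((hcu u).clm_apply (continuous_const (y := v))).intervalIntegrable 0 1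
  rw [happ, happ, ← neg_sub', ← intervalIntegral.integral_sub (hci u v) (hci v u)]
  -- the antisymmetrized integrand is the `t`-derivative of the pulled back form
  have hderiv : ∀ t ∈ Set.uIcc (0 : ℝ) 1, HasDerivAt
      (fun t : ℝ => β (K (x, t)) (fderiv ℝ K (x, t) (u, 0)) (fderiv ℝ K (x, t) (v, 0)))
      (fderiv ℝ Ω (x, t) (u, 0) v - fderiv ℝ Ω (x, t) (v, 0) u) t := by
    intro t _
    have hz : (x, t) ∈ V ×ˢ (Set.univ : Set ℝ) := ⟨hx, trivial⟩
    have pb := fun a b p => fderiv_pullback_apply hV hβ hO hK hKV hz a b p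
    have h1 : HasDerivAt (fun t : ℝ => (x, t)) ((0 : X), (1 : ℝ)) t :=
      (hasDerivAt_const t x).prodMk (hasDerivAt_id t)
    have h2 := ((pb (u, 0) (v, 0) (0, 1)).1.hasFDerivAt).comp_hasDerivAt t h1
    refine HasDerivAt.congr_deriv h2 ?_
    have hsymm : IsSymmSndFDerivAt ℝ K (x, t) :=
      (hK.contDiffAt (hO.mem_nhds hz)).isSymmSndFDerivAt
        (by rw [minSmoothness_of_isRCLikeNormedField]; exact ENat.LEInfty.out)
    rw [hΩ' _ hz, hΩ' _ hz, (pb _ _ _).2, (pb _ _ _).2, (pb _ _ _).2,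
      hsymm.eq (u, 0) (0, 1), hsymm.eq (v, 0) (0, 1), hsymm.eq (v, 0) (u, 0)]
    have hdalt : ∀ p a b, fderiv ℝ β (K (x, t)) p a b = -fderiv ℝ β (K (x, t)) p b a := by
      intro p a b
      have e1 : HasFDerivAt β (fderiv ℝ β (K (x, t))) (K (x, t)) :=
        ((hβ.contDiffAt (hV.mem_nhds (hKV _ hz))).differentiableAt (by simp)).hasFDerivAt
      have e2 : ∀ a b, fderiv ℝ (fun y => β y a b) (K (x, t)) p =
          fderiv ℝ β (K (x, t)) p a b := fun a b => by
        rw [((e1.clm_apply (hasFDerivAt_const a _)).clm_apply (hasFDerivAt_const b _)).fderiv]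
        simp
      have e3 : (fun y => β y a b) =ᶠ[nhds (K (x, t))] fun y => -β y b a := by
        filter_upwards [hV.mem_nhds (hKV _ hz)] with y hy using halt y hy a b
      rw [← e2, ← e2, e3.fderiv_eq, fderiv_fun_neg, neg_apply]
    have h3 := hclosed _ (hKV _ hz) (fderiv ℝ K (x, t) (u, 0)) (fderiv ℝ K (x, t) (v, 0))
      (fderiv ℝ K (x, t) (0, 1))
    have h4 := hdalt (fderiv ℝ K (x, t) (u, 0)) (fderiv ℝ K (x, t) (v, 0))
      (fderiv ℝ K (x, t) (0, 1))
    have h5 := halt _ (hKV _ hz) (fderiv ℝ (fderiv ℝ K) (x, t) (0, 1) (v, 0))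
      (fderiv ℝ K (x, t) (u, 0))
    linarith
  rw [intervalIntegral.integral_eq_sub_of_hasDerivAt hderiv ((hci u v).sub (hci v u))]
  have hK0' : ∀ u, fderiv ℝ K (x, 0) (u, 0) = u ∧ fderiv ℝ K (x, 1) (u, 0) = 0 := by
    intro u
    have hKd : ∀ t : ℝ, HasFDerivAt (fun y => K (y, t)) _ x := fun t =>
      (((hK.contDiffAt (hO.mem_nhds (⟨hx, trivial⟩ : (x, t) ∈ V ×ˢ (Set.univ : Set ℝ)))).differentiableAt
        (by simp)).hasFDerivAt).comp x (hasFDerivAt_prodMk_left x t)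
    have e0 : (fun y => K (y, 0)) =ᶠ[nhds x] id := by
      filter_upwards [hV.mem_nhds hx] with y hy using hK0 y hy
    have e1 : (fun y => K (y, 1)) =ᶠ[nhds x] fun _ => c := by
      filter_upwards [hV.mem_nhds hx] with y hy using hK1 y hy
    have d0 := congrArg (fun L => L u) ((hKd 0).fderiv.symm.trans e0.fderiv_eq)
    have d1 := congrArg (fun L => L u) ((hKd 1).fderiv.symm.trans e1.fderiv_eq)
    exact ⟨by simpa using d0, by simpa using d1⟩
  simp [hK0', hK0 x hx]

end TwoForms

/-! ### Calculus in the coordinates `(xⁱ, yⁱ)` -/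

section CoordinateCalculus

variable {n : ℕ} {D : Set (E n × E n)} {f g : E n × E n → ℝ} {z : E n × E n}

theorem differentiableAt_of_smooth (hD : IsOpen D) (hf : ContDiffOn ℝ ∞ f D) (hz : z ∈ D) :
    DifferentiableAt ℝ f z :=
  (hf.contDiffAt (hD.mem_nhds hz)).differentiableAt (by simp)

theorem smooth_fderiv_apply (hD : IsOpen D) (hf : ContDiffOn ℝ ∞ f D) (p : E n × E n) :
    ContDiffOn ℝ ∞ (fun z => fderiv ℝ f z p) D :=
  (hf.fderiv_of_isOpen (m := ∞) hD (by simp)).clm_apply contDiffOn_const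

theorem smooth_dx (hD : IsOpen D) (hf : ContDiffOn ℝ ∞ f D) (i : Fin n) :
    ContDiffOn ℝ ∞ (dx i f) D := smooth_fderiv_apply hD hf _

theorem smooth_dy (hD : IsOpen D) (hf : ContDiffOn ℝ ∞ f D) (i : Fin n) :
    ContDiffOn ℝ ∞ (dy i f) D := smooth_fderiv_apply hD hf _

theorem contDiff_snd_coord (k : Fin n) : ContDiff ℝ ∞ fun w : E n × E n => w.2 k := by
  fun_prop

theorem fderiv_snd_coord (k : Fin n) (p : E n × E n) :
    fderiv ℝ (fun w : E n × E n => w.2 k) z p = p.2 k := by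
  have h : HasFDerivAt (fun w : E n × E n => w.2 k)
      ((EuclideanSpace.proj k).comp (ContinuousLinearMap.snd ℝ (E n) (E n))) z :=
    ((EuclideanSpace.proj k).comp (ContinuousLinearMap.snd ℝ (E n) (E n))).hasFDerivAt
  rw [h.fderiv]
  simp

/-- Product rule for a sum of products. -/
theorem fderiv_sum_mul {a b : Fin n → E n × E n → ℝ} (ha : ∀ k, DifferentiableAt ℝ (a k) z)
    (hb : ∀ k, DifferentiableAt ℝ (b k) z) (p : E n × E n) :
    fderiv ℝ (fun w => ∑ k, a k w * b k w) z p =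
      ∑ k, (fderiv ℝ (a k) z p * b k z + a k z * fderiv ℝ (b k) z p) := by
  rw [fderiv_fun_sum fun k _ => (ha k).fun_mul (hb k)]
  simp only [sum_apply]
  refine Finset.sum_congr rfl fun k _ => ?_
  rw [fderiv_fun_mul (ha k) (hb k)]
  simp
  ring

theorem fderiv_congr_of_eqOn (hD : IsOpen D) (hfg : ∀ w ∈ D, f w = g w) (hz : z ∈ D) :
    fderiv ℝ f z = fderiv ℝ g z :=
  Filter.EventuallyEq.fderiv_eq (by filter_upwards [hD.mem_nhds hz] with w hw using hfg w hw)

theorem fderiv_fderiv_comm (hD : IsOpen D) (hf : ContDiffOn ℝ ∞ f D) (hz : z ∈ D)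
    (p q : E n × E n) :
    fderiv ℝ (fun w => fderiv ℝ f w p) z q = fderiv ℝ (fun w => fderiv ℝ f w q) z p := by
  have h : DifferentiableAt ℝ (fderiv ℝ f) z :=
    ((hf.fderiv_of_isOpen (m := ∞) hD (by simp)).contDiffAt (hD.mem_nhds hz)).differentiableAt
      (by simp)
  have e : ∀ p q, fderiv ℝ (fun w => fderiv ℝ f w p) z q = fderiv ℝ (fderiv ℝ f) z q p := by
    intro p q
    rw [(h.hasFDerivAt.clm_apply (hasFDerivAt_const p z)).fderiv]
    simp
  have hs : IsSymmSndFDerivAt ℝ f z := (hf.contDiffAt (hD.mem_nhds hz)).isSymmSndFDerivAt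
    (by rw [minSmoothness_of_isRCLikeNormedField]; exact ENat.LEInfty.out)
  rw [e, e, hs.eq]

theorem dy_dx_comm (hD : IsOpen D) (hf : ContDiffOn ℝ ∞ f D) (hz : z ∈ D) (i j : Fin n) :
    dy i (dx j f) z = dx j (dy i f) z := fderiv_fderiv_comm hD hf hz _ _

theorem dy_dy_comm (hD : IsOpen D) (hf : ContDiffOn ℝ ∞ f D) (hz : z ∈ D) (i j : Fin n) :
    dy i (dy j f) z = dy j (dy i f) z := fderiv_fderiv_comm hD hf hz _ _

theorem dx_dx_comm (hD : IsOpen D) (hf : ContDiffOn ℝ ∞ f D) (hz : z ∈ D) (i j : Fin n) :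
    dx i (dx j f) z = dx j (dx i f) z := fderiv_fderiv_comm hD hf hz _ _

theorem sum_smul_single (v : E n) : ∑ k, v k • EuclideanSpace.single k (1 : ℝ) = v := by
  ext i
  simp [Finset.sum_apply, Pi.single_apply]

theorem fderiv_eq_sum (v w : E n) :
    fderiv ℝ f z (v, w) = ∑ k, (v k * dx k f z + w k * dy k f z) := by
  have h : (v, w) = ∑ k, (v k • ((EuclideanSpace.single k (1 : ℝ), 0) : E n × E n) +
      w k • ((0, EuclideanSpace.single k (1 : ℝ)) : E n × E n)) := by
    rw [Finset.sum_add_distrib]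
    ext1
    · simp [Prod.fst_sum, sum_smul_single]
    · simp [Prod.snd_sum, sum_smul_single]
  rw [h, map_sum]
  simp only [map_add, map_smul, smul_eq_mul, dx, dy]

/-- The value of the spray with coefficients `G`, as a vector of the coordinate space. -/
noncomputable def sprayVector (G : Fin n → E n × E n → ℝ) (z : E n × E n) : E n × E n :=
  (z.2, WithLp.toLp 2 fun k => -2 * G k z)

/-- The value of the horizontal field `Hᵢ`, as a vector of the coordinate space. -/
noncomputable def horizVector (G : Fin n → E n × E n → ℝ) (i : Fin n) (z : E n × E n) :
    E n × E n :=
  (EuclideanSpace.single i 1, WithLp.toLp 2 fun k => -conn G k i z)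

variable (G : Fin n → E n × E n → ℝ)

theorem along_eq_fderiv (f : E n × E n → ℝ) (z : E n × E n) :
    along G f z = fderiv ℝ f z (sprayVector G z) := by
  rw [sprayVector, fderiv_eq_sum, along]
  exact Finset.sum_congr rfl fun k _ => by simp; ring

theorem horiz_eq_fderiv (i : Fin n) (f : E n × E n → ℝ) (z : E n × E n) :
    horiz G i f z = fderiv ℝ f z (horizVector G i z) := by
  rw [horizVector, fderiv_eq_sum, horiz, Finset.sum_add_distrib, sub_eq_add_neg]
  congr 1
  · simp
  · simp

variable {G}

theorem smooth_conn (hD : IsOpen D) (hG : ∀ k, ContDiffOn ℝ ∞ (G k) D) (i j : Fin n) :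
    ContDiffOn ℝ ∞ (conn G i j) D := smooth_dy hD (hG i) j

theorem smooth_along (hD : IsOpen D) (hG : ∀ k, ContDiffOn ℝ ∞ (G k) D)
    (hf : ContDiffOn ℝ ∞ f D) : ContDiffOn ℝ ∞ (along G f) D :=
  ContDiffOn.sum fun k _ => ((contDiff_snd_coord k).contDiffOn.mul (smooth_dx hD hf k)).sub
    ((contDiffOn_const.mul (hG k)).mul (smooth_dy hD hf k))

theorem smooth_horiz (hD : IsOpen D) (hG : ∀ k, ContDiffOn ℝ ∞ (G k) D)
    (hf : ContDiffOn ℝ ∞ f D) (i : Fin n) : ContDiffOn ℝ ∞ (horiz G i f) D :=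
  (smooth_dx hD hf i).sub (ContDiffOn.sum fun j _ =>
    (smooth_conn hD hG j i).mul (smooth_dy hD hf j))

/-- The derivative of `Γ(f)` in a constant direction `p`. -/
theorem fderiv_along (hD : IsOpen D) (hG : ∀ k, ContDiffOn ℝ ∞ (G k) D)
    (hf : ContDiffOn ℝ ∞ f D) (hz : z ∈ D) (p : E n × E n) :
    fderiv ℝ (along G f) z p = along G (fun w => fderiv ℝ f w p) z +
      ∑ k, (p.2 k * dx k f z - 2 * fderiv ℝ (G k) z p * dy k f z) := by
  have d := fun {f} (hf : ContDiffOn ℝ ∞ f D) => differentiableAt_of_smooth hD hf hz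
  have hy := fun k : Fin n => (contDiff_snd_coord k).contDiffOn (s := D)
  have e : along G f = fun w => ∑ k, w.2 k * dx k f w - ∑ k, G k w * (2 * dy k f w) := by
    ext w
    rw [along, ← Finset.sum_sub_distrib]
    exact Finset.sum_congr rfl fun k _ => by ring
  have s2 : ∀ k, ContDiffOn ℝ ∞ (fun w => 2 * dy k f w) D := fun k =>
    contDiffOn_const.mul (smooth_dy hD hf k)
  rw [e, fderiv_fun_sub, sub_apply, fderiv_sum_mul (fun k => d (hy k)) fun k =>
    d (smooth_dx hD hf k), fderiv_sum_mul (fun k => d (hG k)) fun k => d (s2 k), along,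
    ← Finset.sum_sub_distrib, ← Finset.sum_add_distrib]
  · refine Finset.sum_congr rfl fun k _ => ?_
    rw [fderiv_const_mul (d (smooth_dy hD hf k)), fderiv_snd_coord]
    have e1 : fderiv ℝ (dx k f) z p = dx k (fun w => fderiv ℝ f w p) z :=
      fderiv_fderiv_comm hD hf hz _ _
    have e2 : fderiv ℝ (dy k f) z p = dy k (fun w => fderiv ℝ f w p) z :=
      fderiv_fderiv_comm hD hf hz _ _
    rw [e1, smul_apply, e2, smul_eq_mul]
    ring
  · exact d (ContDiffOn.sum fun k _ => (hy k).mul (smooth_dx hD hf k))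
  · exact d (ContDiffOn.sum fun k _ => (hG k).mul (s2 k))

theorem dy_along (hD : IsOpen D) (hG : ∀ k, ContDiffOn ℝ ∞ (G k) D)
    (hf : ContDiffOn ℝ ∞ f D) (hz : z ∈ D) (j : Fin n) :
    dy j (along G f) z =
      along G (dy j f) z + dx j f z - 2 * ∑ k, conn G k j z * dy k f z := by
  rw [dy, fderiv_along hD hG hf hz, Finset.sum_sub_distrib, Finset.mul_sum, ← add_sub_assoc]
  congr 1
  · congr 1
    simp
  · exact Finset.sum_congr rfl fun k _ => mul_assoc _ _ _

theorem dx_along (hD : IsOpen D) (hG : ∀ k, ContDiffOn ℝ ∞ (G k) D)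
    (hf : ContDiffOn ℝ ∞ f D) (hz : z ∈ D) (j : Fin n) :
    dx j (along G f) z = along G (dx j f) z - 2 * ∑ k, dx j (G k) z * dy k f z := by
  rw [dx, fderiv_along hD hG hf hz, Finset.sum_sub_distrib, Finset.mul_sum, sub_eq_add_neg]
  congr 1
  simp only [PiLp.zero_apply, zero_mul, Finset.sum_const_zero, zero_add]
  exact congrArg Neg.neg (Finset.sum_congr rfl fun k _ => mul_assoc _ _ _)

/-- The commutator `[Γ, Hᵢ] = Γᵏᵢ Hₖ + Rᵏᵢ ∂/∂yᵏ`. -/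
theorem along_horiz (hD : IsOpen D) (hG : ∀ k, ContDiffOn ℝ ∞ (G k) D)
    (hf : ContDiffOn ℝ ∞ f D) (hz : z ∈ D) (i : Fin n) :
    along G (horiz G i f) z = horiz G i (along G f) z + ∑ k, conn G k i z * horiz G k f z +
      ∑ k, riemann G k i z * dy k f z := by
  have d := fun {f} (hf : ContDiffOn ℝ ∞ f D) => differentiableAt_of_smooth hD hf hz
  have hc := fun j k => smooth_conn hD hG j k
  have h1 : along G (horiz G i f) z = along G (dx i f) z -
      ∑ j, (along G (conn G j i) z * dy j f z + conn G j i z * along G (dy j f) z) := by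
    rw [along_eq_fderiv, show horiz G i f = fun w => dx i f w - ∑ j, conn G j i w * dy j f w
      from rfl, fderiv_fun_sub (d (smooth_dx hD hf i)) (d (ContDiffOn.sum fun j _ =>
      (hc j i).mul (smooth_dy hD hf j))), sub_apply, fderiv_sum_mul (fun j => d (hc j i))
      fun j => d (smooth_dy hD hf j)]
    simp only [← along_eq_fderiv]
  have h2 : horiz G i (along G f) z = along G (dx i f) z - 2 * ∑ k, dx i (G k) z * dy k f z -
      ∑ j, conn G j i z * (along G (dy j f) z + dx j f z - 2 * ∑ k, conn G k j z * dy k f z) := by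
    rw [horiz, dx_along hD hG hf hz]
    simp only [dy_along hD hG hf hz]
  rw [h1, h2]
  -- the three double sums `Γʲᵢ Γᵏⱼ ∂f/∂yᵏ` agree up to the names of the indices
  have h3 : ∑ j, conn G j i z * (∑ k, conn G k j z * dy k f z) =
      ∑ k, (∑ j, conn G j i z * conn G k j z) * dy k f z := by
    simp only [Finset.mul_sum, Finset.sum_mul]
    rw [Finset.sum_comm]
    exact Finset.sum_congr rfl fun k _ => Finset.sum_congr rfl fun j _ => by ring
  have h4 : ∑ k, riemann G k i z * dy k f z = 2 * ∑ k, dx i (G k) z * dy k f z -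
      ∑ k, along G (conn G k i) z * dy k f z -
      ∑ k, (∑ j, conn G j i z * conn G k j z) * dy k f z := by
    rw [Finset.mul_sum, ← Finset.sum_sub_distrib, ← Finset.sum_sub_distrib]
    refine Finset.sum_congr rfl fun k _ => ?_
    rw [riemann, horiz]
    simp only [show ∀ j, dy j (G k) z = conn G k j z from fun _ => rfl]
    ring
  have h5 : ∑ k, conn G k i z * horiz G k f z = ∑ k, conn G k i z * dx k f z -
      ∑ j, conn G j i z * (∑ k, conn G k j z * dy k f z) := by
    rw [← Finset.sum_sub_distrib]
    exact Finset.sum_congr rfl fun k _ => by rw [horiz]; ring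
  have h6 : ∑ j, conn G j i z * (along G (dy j f) z + dx j f z -
      2 * ∑ k, conn G k j z * dy k f z) = ∑ j, conn G j i z * along G (dy j f) z +
      ∑ j, conn G j i z * dx j f z - 2 * ∑ j, conn G j i z * (∑ k, conn G k j z * dy k f z) := by
    rw [Finset.mul_sum, ← Finset.sum_add_distrib, ← Finset.sum_sub_distrib]
    exact Finset.sum_congr rfl fun k _ => by ring
  rw [h4, h5, h6, Finset.sum_add_distrib, h3]
  ring

end CoordinateCalculus

/-! ### The Euler-Lagrange expressions and their integrability conditions -/

section EulerLagrangeForm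

variable {n : ℕ} {D : Set (E n × E n)} {z : E n × E n} {G : Fin n → E n × E n → ℝ}
  {F : E n × E n → ℝ} {h : Fin n → Fin n → E n × E n → ℝ}

/-- The Euler-Lagrange expressions `Eᵢ = Γ(∂F/∂yⁱ) - ∂F/∂xⁱ`. -/
noncomputable def eulerForm (G : Fin n → E n × E n → ℝ) (F : E n × E n → ℝ) (i : Fin n)
    (z : E n × E n) : ℝ :=
  along G (dy i F) z - dx i F z

/-- The two-form `ωᵢⱼ = Hⱼ(∂F/∂yⁱ) - Hᵢ(∂F/∂yʲ)`. -/
noncomputable def horizCurl (G : Fin n → E n × E n → ℝ) (F : E n × E n → ℝ) (i j : Fin n)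
    (z : E n × E n) : ℝ :=
  horiz G j (dy i F) z - horiz G i (dy j F) z

theorem horizCurl_swap (i j : Fin n) : horizCurl G F i j z = -horizCurl G F j i z := by
  simp [horizCurl]

theorem along_congr {f g : E n × E n → ℝ} (hD : IsOpen D) (hfg : ∀ w ∈ D, f w = g w)
    (hz : z ∈ D) : along G f z = along G g z := by
  rw [along_eq_fderiv, along_eq_fderiv, fderiv_congr_of_eqOn hD hfg hz]

theorem horiz_congr {f g : E n × E n → ℝ} (hD : IsOpen D) (hfg : ∀ w ∈ D, f w = g w)
    (hz : z ∈ D) (i : Fin n) : horiz G i f z = horiz G i g z := by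
  rw [horiz_eq_fderiv, horiz_eq_fderiv, fderiv_congr_of_eqOn hD hfg hz]

theorem dy_congr {f g : E n × E n → ℝ} (hD : IsOpen D) (hfg : ∀ w ∈ D, f w = g w)
    (hz : z ∈ D) (i : Fin n) : dy i f z = dy i g z := by
  rw [dy, dy, fderiv_congr_of_eqOn hD hfg hz]

theorem dx_congr {f g : E n × E n → ℝ} (hD : IsOpen D) (hfg : ∀ w ∈ D, f w = g w)
    (hz : z ∈ D) (i : Fin n) : dx i f z = dx i g z := by
  rw [dx, dx, fderiv_congr_of_eqOn hD hfg hz]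

theorem smooth_eulerForm (hD : IsOpen D) (hG : ∀ k, ContDiffOn ℝ ∞ (G k) D)
    (hF : ContDiffOn ℝ ∞ F D) (i : Fin n) : ContDiffOn ℝ ∞ (eulerForm G F i) D :=
  (smooth_along hD hG (smooth_dy hD hF i)).sub (smooth_dx hD hF i)

theorem smooth_horizCurl (hD : IsOpen D) (hG : ∀ k, ContDiffOn ℝ ∞ (G k) D)
    (hF : ContDiffOn ℝ ∞ F D) (i j : Fin n) : ContDiffOn ℝ ∞ (horizCurl G F i j) D :=
  (smooth_horiz hD hG (smooth_dy hD hF i) j).sub (smooth_horiz hD hG (smooth_dy hD hF j) i)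

/-- The fibre derivative of the Euler-Lagrange expressions has symmetric part `∇h` and
antisymmetric part `ω`. -/
theorem dy_eulerForm (hD : IsOpen D) (hG : ∀ k, ContDiffOn ℝ ∞ (G k) D)
    (hF : ContDiffOn ℝ ∞ F D) (hh : ∀ w ∈ D, ∀ i j, h i j w = dy i (dy j F) w) (hz : z ∈ D)
    (i j : Fin n) :
    dy j (eulerForm G F i) z = dynCov G h i j z + horizCurl G F i j z := by
  have e1 : dy j (eulerForm G F i) z = dy j (along G (dy i F)) z - dy j (dx i F) z := by
    rw [dy, show eulerForm G F i = fun w => along G (dy i F) w - dx i F w from rfl,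
      fderiv_fun_sub (differentiableAt_of_smooth hD (smooth_along hD hG (smooth_dy hD hF i)) hz)
      (differentiableAt_of_smooth hD (smooth_dx hD hF i) hz), sub_apply, dy, dy]
  have e2 : along G (dy j (dy i F)) z = along G (h i j) z :=
    along_congr hD (fun w hw => by rw [hh w hw, dy_dy_comm hD hF hw]) hz
  have e3 : ∑ k, conn G k j z * dy k (dy i F) z = ∑ k, conn G k j z * h i k z :=
    Finset.sum_congr rfl fun k _ => by rw [hh z hz, dy_dy_comm hD hF hz]
  have e4 : ∑ k, conn G k i z * dy k (dy j F) z = ∑ k, conn G k i z * h k j z :=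
    Finset.sum_congr rfl fun k _ => by rw [hh z hz]
  rw [e1, dy_along hD hG (smooth_dy hD hF i) hz, dy_dx_comm hD hF hz, e2, dynCov, horizCurl,
    horiz, horiz, e3, e4]
  ring

/-- The derivative of `ω` along the spray; its last term is the obstruction to the symmetry of
`h` with respect to the Riemann curvature. -/
theorem along_horizCurl (hD : IsOpen D) (hG : ∀ k, ContDiffOn ℝ ∞ (G k) D)
    (hF : ContDiffOn ℝ ∞ F D) (hh : ∀ w ∈ D, ∀ i j, h i j w = dy i (dy j F) w) (hz : z ∈ D)
    (i j : Fin n) :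
    along G (horizCurl G F i j) z =
      horiz G j (eulerForm G F i) z - horiz G i (eulerForm G F j) z +
        (∑ k, conn G k j z * horizCurl G F i k z - ∑ k, conn G k i z * horizCurl G F j k z) +
        (∑ k, h i k z * riemann G k j z - ∑ k, h j k z * riemann G k i z) := by
  have d := fun {f} (hf : ContDiffOn ℝ ∞ f D) => differentiableAt_of_smooth hD hf hz
  have sθ := fun i => smooth_dy hD hF i
  have e1 : along G (horizCurl G F i j) z =
      along G (horiz G j (dy i F)) z - along G (horiz G i (dy j F)) z := by
    rw [along_eq_fderiv, show horizCurl G F i j =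
      fun w => horiz G j (dy i F) w - horiz G i (dy j F) w from rfl,
      fderiv_fun_sub (d (smooth_horiz hD hG (sθ i) j)) (d (smooth_horiz hD hG (sθ j) i)),
      sub_apply, ← along_eq_fderiv, ← along_eq_fderiv]
  have e2 : ∀ i j, horiz G j (along G (dy i F)) z =
      horiz G j (eulerForm G F i) z + horiz G j (dx i F) z := by
    intro i j
    rw [horiz_eq_fderiv, show along G (dy i F) = fun w => eulerForm G F i w + dx i F w from
      funext fun w => by simp [eulerForm], fderiv_fun_add (d (smooth_eulerForm hD hG hF i))
      (d (smooth_dx hD hF i)), add_apply, ← horiz_eq_fderiv, ← horiz_eq_fderiv]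
  have e3 : ∀ i j, horiz G j (dx i F) z = dx j (dx i F) z -
      ∑ k, conn G k j z * horiz G i (dy k F) z -
      ∑ k, ∑ l, conn G k j z * conn G l i z * h l k z := by
    intro i j
    rw [horiz, sub_sub, ← Finset.sum_add_distrib]
    congr 1
    refine Finset.sum_congr rfl fun k _ => ?_
    rw [horiz, dy_dx_comm hD hF hz, mul_sub, Finset.mul_sum]
    simp only [hh z hz, mul_assoc]
    ring
  have e4 : ∑ k, ∑ l, conn G k j z * conn G l i z * h l k z =
      ∑ k, ∑ l, conn G k i z * conn G l j z * h l k z := by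
    rw [Finset.sum_comm]
    refine Finset.sum_congr rfl fun k _ => Finset.sum_congr rfl fun l _ => ?_
    rw [hh z hz, hh z hz, dy_dy_comm hD hF hz]
    ring
  have e5 : ∀ i j, ∑ k, riemann G k j z * dy k (dy i F) z = ∑ k, h i k z * riemann G k j z :=
    fun i j => Finset.sum_congr rfl fun k _ => by
      rw [hh z hz, dy_dy_comm hD hF hz]; ring
  have e6 : ∀ i j, ∑ k, conn G k j z * horizCurl G F i k z =
      ∑ k, conn G k j z * horiz G k (dy i F) z - ∑ k, conn G k j z * horiz G i (dy k F) z := by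
    intro i j
    rw [← Finset.sum_sub_distrib]
    exact Finset.sum_congr rfl fun k _ => by rw [horizCurl]; ring
  rw [e1, along_horiz hD hG (sθ i) hz, along_horiz hD hG (sθ j) hz, e2, e2, e3, e3, e4, e5, e5,
    e6, e6, dx_dx_comm hD hF hz]
  ring

/-- The Euler identity of a positively homogeneous function. -/
theorem sum_snd_mul_dy_eq (hD : IsOpen D) (hF : ContDiffOn ℝ ∞ F D)
    (hhom : ∀ z ∈ D, ∀ t : ℝ, 0 < t → F (z.1, t • z.2) = t * F z) (hz : z ∈ D) :
    ∑ k, z.2 k * dy k F z = F z := by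
  have h1 : HasDerivAt (fun t : ℝ => (z.1, t • z.2)) ((0 : E n), z.2) 1 := by
    simpa using (hasDerivAt_const (1 : ℝ) z.1).prodMk ((hasDerivAt_id (1 : ℝ)).smul_const z.2)
  have h2 : HasFDerivAt F (fderiv ℝ F z) ((fun t : ℝ => (z.1, t • z.2)) 1) := by
    simpa using (differentiableAt_of_smooth hD hF hz).hasFDerivAt
  have h3 := h2.comp_hasDerivAt (1 : ℝ) h1
  have h4 : HasDerivAt (fun t : ℝ => t * F z) (F z) 1 := by
    simpa using (hasDerivAt_id (1 : ℝ)).mul_const (F z)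
  have h5 : (F ∘ fun t : ℝ => (z.1, t • z.2)) =ᶠ[nhds 1] fun t : ℝ => t * F z := by
    filter_upwards [lt_mem_nhds zero_lt_one] with t ht using hhom z hz t ht
  have h6 := (h3.congr_of_eventuallyEq h5.symm).unique h4
  rw [← h6, fderiv_eq_sum]
  simp

/-- The fibre derivative of the Euler identity. -/
theorem sum_hessian_mul_snd_eq_zero (hD : IsOpen D) (hF : ContDiffOn ℝ ∞ F D)
    (heuler : ∀ z ∈ D, ∑ k, z.2 k * dy k F z = F z) (hz : z ∈ D) (i : Fin n) :
    ∑ j, dy i (dy j F) z * z.2 j = 0 := by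
  have h1 : dy i (fun w => ∑ k, w.2 k * dy k F w) z = dy i F z := dy_congr hD heuler hz i
  rw [dy, fderiv_sum_mul (fun k => by fun_prop)
    fun k => differentiableAt_of_smooth hD (smooth_dy hD hF k) hz, Finset.sum_add_distrib] at h1
  have h2 : ∑ k, fderiv ℝ (fun w : E n × E n => w.2 k) z (0, EuclideanSpace.single i 1) *
      dy k F z = dy i F z := by
    simp [fderiv_snd_coord]
  rw [h2] at h1
  rw [← add_eq_left.1 h1]
  exact Finset.sum_congr rfl fun k _ => mul_comm _ _

/-- Necessity: the Hessian `h` of a Lagrangian of the spray satisfies `∇h = 0` and is symmetric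
with respect to the Riemann curvature. -/
theorem helmholtz_of_eulerForm_eq_zero (hD : IsOpen D) (hG : ∀ k, ContDiffOn ℝ ∞ (G k) D)
    (hF : ContDiffOn ℝ ∞ F D) (hh : ∀ w ∈ D, ∀ i j, h i j w = dy i (dy j F) w)
    (hE : ∀ w ∈ D, ∀ i, eulerForm G F i w = 0) (hz : z ∈ D) (i j : Fin n) :
    dynCov G h i j z = 0 ∧
      ∑ k, h i k z * riemann G k j z = ∑ k, h j k z * riemann G k i z := by
  have hzero : ∀ p : E n × E n, ∀ w ∈ D, ∀ i, fderiv ℝ (eulerForm G F i) w p = 0 := by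
    intro p w hw i
    rw [fderiv_congr_of_eqOn (g := fun _ => 0) hD (fun w hw => hE w hw i) hw]
    simp
  have hsum : ∀ w ∈ D, ∀ i j, dynCov G h i j w + horizCurl G F i j w = 0 := by
    intro w hw i j
    rw [← dy_eulerForm hD hG hF hh hw]
    exact hzero _ w hw i
  have hsymm : ∀ w ∈ D, ∀ i j, dynCov G h i j w = dynCov G h j i w := by
    intro w hw i j
    have hs : ∀ w ∈ D, ∀ i j, h i j w = h j i w := fun w hw i j => by
      rw [hh w hw, hh w hw, dy_dy_comm hD hF hw]
    have e1 : ∀ i j, ∑ k, conn G k j w * h i k w = ∑ k, conn G k j w * h k i w := fun i j =>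
      Finset.sum_congr rfl fun k _ => by rw [hs w hw i k]
    rw [dynCov, dynCov, along_congr hD (fun w hw => hs w hw i j) hw, e1, e1]
    ring
  have hcurl : ∀ w ∈ D, ∀ i j, horizCurl G F i j w = 0 := by
    intro w hw i j
    have h1 := hsum w hw i j
    have h2 := hsum w hw j i
    rw [horizCurl_swap, ← hsymm w hw] at h2
    linarith
  refine ⟨by simpa [hcurl z hz] using hsum z hz i j, ?_⟩
  have h1 := along_horizCurl hD hG hF hh hz i j
  rw [along_congr (g := fun _ => 0) hD (fun w hw => hcurl w hw i j) hz, horiz_eq_fderiv,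
    horiz_eq_fderiv, hzero _ z hz, hzero _ z hz, along_eq_fderiv] at h1
  simp [hcurl z hz] at h1
  linarith

/-- The relation `hᵢₖ (2 Γᵏ - Γᵏⱼ yʲ) = 0`, a consequence of `∇h = 0` and `hᵢⱼ yʲ = 0`. -/
theorem sum_hessian_mul_sprayDefect (hD : IsOpen D)
    (hhs : ∀ i j, ContDiffOn ℝ ∞ (h i j) D)
    (hcontract : ∀ w ∈ D, ∀ i, ∑ j, h i j w * w.2 j = 0)
    (hcov : ∀ w ∈ D, ∀ i j, dynCov G h i j w = 0) (hz : z ∈ D) (i : Fin n) :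
    2 * ∑ k, G k z * h i k z = ∑ k, ∑ j, conn G k j z * z.2 j * h i k z := by
  have h1 : ∑ j, dynCov G h i j z * z.2 j = 0 := by simp [hcov z hz]
  have h2 : along G (fun w => ∑ j, h i j w * w.2 j) z = 0 := by
    rw [along_congr (g := fun _ => 0) hD (fun w hw => hcontract w hw i) hz, along_eq_fderiv]
    simp
  rw [along_eq_fderiv, fderiv_sum_mul (fun j => differentiableAt_of_smooth hD (hhs i j) hz)
    fun k => by fun_prop, Finset.sum_add_distrib] at h2
  simp only [fderiv_snd_coord] at h2
  simp only [← along_eq_fderiv] at h2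
  simp only [sprayVector] at h2
  have h3 : ∑ j, dynCov G h i j z * z.2 j = ∑ j, along G (h i j) z * z.2 j -
      ∑ k, conn G k i z * (∑ j, h k j z * z.2 j) -
      ∑ k, ∑ j, conn G k j z * z.2 j * h i k z := by
    rw [Finset.sum_comm (f := fun k j => conn G k j z * z.2 j * h i k z)]
    simp only [Finset.mul_sum]
    rw [Finset.sum_comm (f := fun k j => conn G k i z * (h k j z * z.2 j)),
      ← Finset.sum_sub_distrib, ← Finset.sum_sub_distrib]
    refine Finset.sum_congr rfl fun j _ => ?_
    rw [dynCov, sub_mul, sub_mul, Finset.sum_mul, Finset.sum_mul]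
    simp only [mul_assoc]
    congr 1
    exact Finset.sum_congr rfl fun k _ => by ring
  have h4 : ∑ j, h i j z * (-2 * G j z) = -(2 * ∑ k, G k z * h i k z) := by
    rw [Finset.mul_sum, ← Finset.sum_neg_distrib]
    exact Finset.sum_congr rfl fun k _ => by ring
  simp only [hcontract z hz, mul_zero, Finset.sum_const_zero] at h3
  rw [h4] at h2
  linarith

/-- If `∇h = 0`, the Euler-Lagrange expressions are `Eᵢ = ωᵢⱼ yʲ`. -/
theorem eulerForm_eq_sum_horizCurl (hD : IsOpen D)
    (hF : ContDiffOn ℝ ∞ F D) (heuler : ∀ z ∈ D, ∑ k, z.2 k * dy k F z = F z)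
    (hhs : ∀ i j, ContDiffOn ℝ ∞ (h i j) D) (hh : ∀ w ∈ D, ∀ i j, h i j w = dy i (dy j F) w)
    (hcov : ∀ w ∈ D, ∀ i j, dynCov G h i j w = 0) (hz : z ∈ D) (i : Fin n) :
    eulerForm G F i z = ∑ j, horizCurl G F i j z * z.2 j := by
  have hcontract : ∀ w ∈ D, ∀ i, ∑ j, h i j w * w.2 j = 0 := fun w hw i => by
    simpa only [hh w hw] using sum_hessian_mul_snd_eq_zero hD hF heuler hw i
  have hdef := sum_hessian_mul_sprayDefect hD hhs hcontract hcov hz i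
  have h1 : ∑ j, z.2 j * dx i (dy j F) z = dx i F z := by
    have e := dx_congr hD heuler hz i
    rw [dx, fderiv_sum_mul (fun k => by fun_prop)
      fun k => differentiableAt_of_smooth hD (smooth_dy hD hF k) hz] at e
    simpa [fderiv_snd_coord, dx] using e
  have h2 : ∑ j, horiz G j (dy i F) z * z.2 j = ∑ j, z.2 j * dx j (dy i F) z -
      ∑ k, ∑ j, conn G k j z * z.2 j * h i k z := by
    rw [Finset.sum_comm, ← Finset.sum_sub_distrib]
    refine Finset.sum_congr rfl fun j _ => ?_
    rw [horiz, sub_mul, Finset.sum_mul, mul_comm]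
    congr 1
    exact Finset.sum_congr rfl fun k _ => by rw [hh z hz, dy_dy_comm hD hF hz]; ring
  have h3 : ∑ j, horiz G i (dy j F) z * z.2 j = ∑ j, z.2 j * dx i (dy j F) z -
      ∑ k, conn G k i z * ∑ j, h k j z * z.2 j := by
    simp only [Finset.mul_sum]
    rw [Finset.sum_comm, ← Finset.sum_sub_distrib]
    refine Finset.sum_congr rfl fun j _ => ?_
    rw [horiz, sub_mul, Finset.sum_mul, mul_comm]
    congr 1
    exact Finset.sum_congr rfl fun k _ => by rw [hh z hz]; ring
  have h4 : along G (dy i F) z = ∑ j, z.2 j * dx j (dy i F) z - 2 * ∑ k, G k z * h i k z := by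
    rw [along, Finset.mul_sum, ← Finset.sum_sub_distrib]
    exact Finset.sum_congr rfl fun k _ => by rw [hh z hz, dy_dy_comm hD hF hz]; ring
  simp only [hcontract z hz, mul_zero, Finset.sum_const_zero, sub_zero] at h3
  simp only [horizCurl, sub_mul, Finset.sum_sub_distrib]
  rw [h2, h3, h1, eulerForm, h4, hdef]

/-- If `∇h = 0`, the coefficients of `ω` do not depend on `y`: their fibre derivatives are
antisymmetric in the first two indices and symmetric in the last two. -/
theorem dy_horizCurl_eq_zero (hD : IsOpen D) (hG : ∀ k, ContDiffOn ℝ ∞ (G k) D)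
    (hF : ContDiffOn ℝ ∞ F D) (hh : ∀ w ∈ D, ∀ i j, h i j w = dy i (dy j F) w)
    (hcov : ∀ w ∈ D, ∀ i j, dynCov G h i j w = 0) (hz : z ∈ D) (i j k : Fin n) :
    dy k (horizCurl G F i j) z = 0 := by
  have hE : ∀ i j, ∀ w ∈ D, dy j (eulerForm G F i) w = horizCurl G F i j w := fun i j w hw => by
    rw [dy_eulerForm hD hG hF hh hw, hcov w hw, zero_add]
  have h1 : ∀ i j k, dy k (horizCurl G F i j) z = dy j (horizCurl G F i k) z := by
    intro i j k
    rw [← dy_congr hD (hE i j) hz, ← dy_congr hD (hE i k) hz,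
      dy_dy_comm hD (smooth_eulerForm hD hG hF i) hz]
  have h2 : ∀ i j k, dy k (horizCurl G F i j) z = -dy k (horizCurl G F j i) z := by
    intro i j k
    rw [dy_congr (g := fun w => -horizCurl G F j i w) hD (fun w _ => horizCurl_swap i j) hz, dy,
      fderiv_fun_neg, neg_apply, dy]
  have := h1 i j k
  have := h2 i k j
  have := h1 k i j
  have := h2 k j i
  have := h1 j k i
  have := h2 j i k
  linarith

end EulerLagrangeForm

/-! ### Construction of the Lagrangian in coordinates -/

section Construction

variable {n : ℕ} {V : Set (E n)}

/-- The linear form with given coefficients. -/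
noncomputable def formOfCoeff (a : Fin n → ℝ) : E n →L[ℝ] ℝ :=
  ∑ j, a j • (EuclideanSpace.proj j : E n →L[ℝ] ℝ)

theorem formOfCoeff_apply (a : Fin n → ℝ) (v : E n) : formOfCoeff a v = ∑ j, a j * v j := by
  simp [formOfCoeff]

theorem fderiv_eq_sum_single {f : E n → ℝ} {x : E n} (u : E n) :
    fderiv ℝ f x u = ∑ k, u k * fderiv ℝ f x (EuclideanSpace.single k 1) := by
  conv_lhs => rw [← sum_smul_single u, map_sum]
  simp

/-- A symmetric tensor along the projection that annihilates `y` and has symmetric fibre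
derivatives is the fibre Hessian of a smooth function that is homogeneous of degree one, namely of
`θᵢ yⁱ` for primitives `θᵢ` of the closed one-forms `hᵢⱼ dyʲ` on the fibres. -/
theorem exists_homogeneous_of_hessian (hn : 3 ≤ n) (hV : IsOpen V)
    {h : Fin n → Fin n → E n × E n → ℝ} (hh : ∀ i j, ContDiffOn ℝ ∞ (h i j) (V ×ˢ {0}ᶜ))
    (hsymm : ∀ z ∈ V ×ˢ ({0}ᶜ : Set (E n)), ∀ i j, h j i z = h i j z)
    (hcontract : ∀ z ∈ V ×ˢ ({0}ᶜ : Set (E n)), ∀ i, ∑ j, h i j z * z.2 j = 0)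
    (hderiv : ∀ z ∈ V ×ˢ ({0}ᶜ : Set (E n)), ∀ i j k, dy k (h i j) z = dy j (h i k) z) :
    ∃ F : E n × E n → ℝ, ContDiffOn ℝ ∞ F (V ×ˢ {0}ᶜ) ∧
      (∀ z ∈ V ×ˢ ({0}ᶜ : Set (E n)), ∀ t : ℝ, 0 < t → F (z.1, t • z.2) = t * F z) ∧
      ∀ z ∈ V ×ˢ ({0}ᶜ : Set (E n)), ∀ i j, h i j z = dy i (dy j F) z := by
  set D : Set (E n × E n) := V ×ˢ {0}ᶜ
  have hD : IsOpen D := hV.prod isOpen_compl_singleton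
  have hα : ∀ i, ContDiffOn ℝ ∞ (fun z => formOfCoeff fun j => h i j z) D := fun i =>
    ContDiffOn.sum fun j _ => (hh i j).smul contDiffOn_const
  have hαd : ∀ i, ∀ z ∈ D, ∀ u v, fderiv ℝ (fun z => formOfCoeff fun j => h i j z) z (0, u) v =
      ∑ j, ∑ k, u k * dy k (h i j) z * v j := by
    intro i z hz u v
    have h1 := ((((hα i).contDiffAt (hD.mem_nhds hz)).differentiableAt
      (by simp)).hasFDerivAt.clm_apply (hasFDerivAt_const v z)).fderiv
    simp only [formOfCoeff_apply] at h1
    have h2 : ∀ j, HasFDerivAt (fun w => h i j w * v j) (v j • fderiv ℝ (h i j) z) z := fun j =>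
      (differentiableAt_of_smooth hD (hh i j) hz).hasFDerivAt.mul_const (v j)
    have h3 := (HasFDerivAt.fun_sum (u := Finset.univ) fun j _ => h2 j).fderiv
    have h4 := congrArg (fun L => L ((0, u) : E n × E n)) (h1.symm.trans h3)
    simp only [sum_apply, smul_apply, fderiv_eq_sum (0 : E n) u] at h4
    simp only [ContinuousLinearMap.comp_zero, zero_add, ContinuousLinearMap.flip_apply,
      PiLp.zero_apply, zero_mul, smul_eq_mul] at h4
    rw [h4]
    refine Finset.sum_congr rfl fun j _ => ?_
    rw [Finset.mul_sum]
    exact Finset.sum_congr rfl fun k _ => by ring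
  choose θ hθ hθd using fun i => exists_fibre_primitive (X := E n) (by simpa using hn) hV (hα i)
    (fun z hz u v => by
      rw [hαd i z hz, hαd i z hz, Finset.sum_comm]
      refine Finset.sum_congr rfl fun j _ => Finset.sum_congr rfl fun k _ => ?_
      rw [hderiv z hz]
      ring)
  have hθy : ∀ z ∈ D, ∀ i j, dy j (θ i) z = h i j z := fun z hz i j => by
    rw [dy, hθd i z hz, formOfCoeff_apply]
    simp
  have hdy : ∀ z ∈ D, ∀ i, dy i (fun z => ∑ k, z.2 k * θ k z) z = θ i z := by
    intro z hz i
    rw [dy, fderiv_sum_mul (fun k => by fun_prop)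
      fun k => differentiableAt_of_smooth hD (hθ k) hz, Finset.sum_add_distrib]
    have h1 : ∑ k, z.2 k * fderiv ℝ (θ k) z (0, EuclideanSpace.single i 1) = 0 := by
      rw [← hcontract z hz i]
      refine Finset.sum_congr rfl fun k _ => ?_
      rw [hsymm z hz k i, ← hθy z hz, dy, mul_comm]
    rw [h1]
    simp [fderiv_snd_coord]
  refine ⟨fun z => ∑ k, z.2 k * θ k z, ContDiffOn.sum fun k _ =>
    (contDiff_snd_coord k).contDiffOn.mul (hθ k), fun z hz t ht => ?_, fun z hz i j => ?_⟩
  · -- each `θᵢ` is constant along the rays, because `hᵢⱼ yʲ = 0`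
    have hray : ∀ s ∈ Set.Ioi (0 : ℝ), (z.1, s • z.2) ∈ D := fun s hs =>
      ⟨hz.1, smul_ne_zero (ne_of_gt hs) hz.2⟩
    have hconst : ∀ k, θ k (z.1, t • z.2) = θ k z := by
      intro k
      have hd : ∀ s ∈ Set.Ioi (0 : ℝ), HasDerivAt (fun s : ℝ => θ k (z.1, s • z.2)) 0 s := by
        intro s hs
        have h1 : HasDerivAt (fun s : ℝ => (z.1, s • z.2)) ((0 : E n), z.2) s := by
          simpa using (hasDerivAt_const s z.1).prodMk ((hasDerivAt_id s).smul_const z.2)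
        have h2 := (differentiableAt_of_smooth hD (hθ k) (hray s hs)).hasFDerivAt.comp_hasDerivAt
          s h1
        refine h2.congr_deriv ?_
        rw [hθd k _ (hray s hs), formOfCoeff_apply]
        have h3 := hcontract _ (hray s hs) k
        simp only [PiLp.smul_apply, smul_eq_mul, mul_left_comm _ s] at h3
        rw [← Finset.mul_sum] at h3
        exact (mul_eq_zero.1 h3).resolve_left (ne_of_gt hs)
      have h4 := isOpen_Ioi.is_const_of_deriv_eq_zero (convex_Ioi (0 : ℝ)).isPreconnected
        (fun s hs => (hd s hs).differentiableAt.differentiableWithinAt)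
        (fun s hs => (hd s hs).deriv) ht (Set.mem_Ioi.2 one_pos)
      simpa using h4
    simp only [hconst, PiLp.smul_apply, smul_eq_mul, Finset.mul_sum, mul_assoc]
  · rw [dy_congr hD (fun w hw => hdy w hw j) hz, hθy z hz, hsymm z hz]

set_option synthInstance.maxHeartbeats 200000 in
/-- Exactness of closed two-forms in coordinates. -/
theorem exists_potential_of_closed (hV : IsOpen V) [ContractibleSpace V]
    {w : Fin n → Fin n → E n → ℝ} (hw : ∀ i j, ContDiffOn ℝ ∞ (w i j) V)
    (halt : ∀ x ∈ V, ∀ i j, w i j x = -w j i x)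
    (hclosed : ∀ x ∈ V, ∀ i j k, fderiv ℝ (w i j) x (EuclideanSpace.single k 1) +
      fderiv ℝ (w j k) x (EuclideanSpace.single i 1) +
      fderiv ℝ (w k i) x (EuclideanSpace.single j 1) = 0) :
    ∃ φ : Fin n → E n → ℝ, (∀ k, ContDiffOn ℝ ∞ (φ k) V) ∧
      ∀ x ∈ V, ∀ i k, fderiv ℝ (φ k) x (EuclideanSpace.single i 1) -
        fderiv ℝ (φ i) x (EuclideanSpace.single k 1) = w i k x := by
  set β : E n → E n →L[ℝ] E n →L[ℝ] ℝ := fun x =>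
    ∑ i, ∑ j, w i j x • (EuclideanSpace.proj i : E n →L[ℝ] ℝ).smulRight
      (EuclideanSpace.proj j : E n →L[ℝ] ℝ)
  have hβ : ContDiffOn ℝ ∞ β V := ContDiffOn.sum fun i _ => ContDiffOn.sum fun j _ =>
    (ContinuousLinearMap.toSpanSingleton ℝ _).contDiff.comp_contDiffOn (hw i j)
  have hβa : ∀ x u v, β x u v = ∑ i, ∑ j, w i j x * (u i * v j) := by
    intro x u v
    simp [β, sum_apply]
  have hβd : ∀ x ∈ V, ∀ u v y, fderiv ℝ β x u v y =
      ∑ i, ∑ j, ∑ k, fderiv ℝ (w i j) x (EuclideanSpace.single k 1) * (u k * v i * y j) := by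
    intro x hx u v y
    have h1 := ((((hβ.contDiffAt (hV.mem_nhds hx)).differentiableAt
      (by simp)).hasFDerivAt.clm_apply (hasFDerivAt_const v x)).clm_apply
        (hasFDerivAt_const y x)).fderiv
    simp only [hβa] at h1
    have h2 : ∀ i j, HasFDerivAt (fun x => w i j x * (v i * y j))
      ((v i * y j) • fderiv ℝ (w i j) x) x := fun i j =>
      (((hw i j).contDiffAt (hV.mem_nhds hx)).differentiableAt
        (by simp)).hasFDerivAt.mul_const _
    have h3 := (HasFDerivAt.fun_sum (u := Finset.univ) fun i _ =>
      HasFDerivAt.fun_sum (u := Finset.univ) fun j _ => h2 i j).fderiv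
    have h4 := congrArg (fun L => L u) (h1.symm.trans h3)
    simp only [sum_apply, smul_apply, fderiv_eq_sum_single u] at h4
    simp only [ContinuousLinearMap.comp_zero, zero_add, ContinuousLinearMap.flip_apply,
      smul_eq_mul] at h4
    rw [h4]
    exact Finset.sum_congr rfl fun i _ => Finset.sum_congr rfl fun j _ => by
      rw [Finset.mul_sum]; exact Finset.sum_congr rfl fun k _ => by ring
  obtain ⟨φ, hφ, hφd⟩ := exists_primitive_of_closed_two_form hV hβ
    (fun x hx u v => by
      rw [hβa, hβa, Finset.sum_comm, ← Finset.sum_neg_distrib]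
      refine Finset.sum_congr rfl fun i _ => ?_
      rw [← Finset.sum_neg_distrib]
      exact Finset.sum_congr rfl fun j _ => by rw [halt x hx]; ring)
    (fun x hx u v y => by
      -- the cyclic sum is matched with `hclosed` by renaming the indices cyclically
      have rot : ∀ f : Fin n → Fin n → Fin n → ℝ,
          ∑ i, ∑ j, ∑ k, f i j k = ∑ i, ∑ j, ∑ k, f j k i := fun f => by
        conv_rhs => rw [Finset.sum_comm]
        exact Finset.sum_congr rfl fun i _ => Finset.sum_comm
      rw [hβd x hx, hβd x hx, hβd x hx,
        rot (fun i j k => fderiv ℝ (w i j) x (EuclideanSpace.single k 1) * (v k * y i * u j)),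
        rot (fun i j k => fderiv ℝ (w i j) x (EuclideanSpace.single k 1) * (y k * u i * v j)),
        rot (fun i j k => fderiv ℝ (w j k) x (EuclideanSpace.single i 1) * (y i * u j * v k))]
      simp only [← Finset.sum_add_distrib]
      refine Finset.sum_eq_zero fun i _ => Finset.sum_eq_zero fun j _ =>
        Finset.sum_eq_zero fun k _ => ?_
      linear_combination (u k * v i * y j) * hclosed x hx i j k)
  have hφ1 : ∀ x ∈ V, ∀ k u, fderiv ℝ (fun x => φ x (EuclideanSpace.single k 1)) x u =
      fderiv ℝ φ x u (EuclideanSpace.single k 1) := by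
    intro x hx k u
    rw [((((hφ.contDiffAt (hV.mem_nhds hx)).differentiableAt
      (by simp)).hasFDerivAt).clm_apply (hasFDerivAt_const _ x)).fderiv]
    simp
  refine ⟨fun k x => φ x (EuclideanSpace.single k 1), fun k => hφ.clm_apply contDiffOn_const,
    fun x hx i k => ?_⟩
  rw [hφ1 x hx, hφ1 x hx, hφd x hx, hβa]
  simp

theorem fderiv_comp_fst {a : E n → ℝ} {z : E n × E n} (ha : DifferentiableAt ℝ a z.1)
    (p : E n × E n) : fderiv ℝ (fun w : E n × E n => a w.1) z p = fderiv ℝ a z.1 p.1 := by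
  have h : HasFDerivAt (fun w : E n × E n => a w.1) _ z := ha.hasFDerivAt.comp z hasFDerivAt_fst
  rw [h.fderiv]
  simp

/-- A function with vanishing fibre derivatives does not depend on `y`. -/
theorem eq_of_dy_eq_zero (hn : 3 ≤ n) (hV : IsOpen V) {f : E n × E n → ℝ}
    (hf : ContDiffOn ℝ ∞ f (V ×ˢ {0}ᶜ)) (hdy : ∀ z ∈ V ×ˢ ({0}ᶜ : Set (E n)), ∀ k, dy k f z = 0)
    {x y b : E n} (hx : x ∈ V) (hy : y ≠ 0) (hb : b ≠ 0) : f (x, y) = f (x, b) := by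
  have hD : IsOpen (V ×ˢ ({0}ᶜ : Set (E n))) := hV.prod isOpen_compl_singleton
  have hconn : IsPreconnected ({0}ᶜ : Set (E n)) := by
    refine (isConnected_compl_singleton_of_one_lt_rank ?_ 0).isPreconnected
    rw [← Module.finrank_eq_rank]
    exact_mod_cast (by simp; omega : 1 < Module.finrank ℝ (E n))
  have hd : ∀ y ∈ ({0}ᶜ : Set (E n)), HasFDerivAt (𝕜 := ℝ) (fun y => f (x, y)) 0 y := by
    intro y hy
    have h1 := (differentiableAt_of_smooth hD hf (z := (x, y)) ⟨hx, hy⟩).hasFDerivAt.comp y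
      (hasFDerivAt_prodMk_right x y)
    refine h1.congr_fderiv ?_
    ext u
    simp [fderiv_eq_sum, hdy (x, y) ⟨hx, hy⟩]
  exact isOpen_compl_singleton.is_const_of_fderiv_eq_zero hconn
    (fun y hy => (hd y hy).differentiableAt.differentiableWithinAt) (fun y hy => (hd y hy).fderiv)
    hy hb

/-- Sufficiency: a tensor satisfying the differential conditions is the Hessian of a Lagrangian of
the spray that is homogeneous of degree one. Any homogeneous function with this Hessian has
Euler-Lagrange expressions `ωᵢⱼ yʲ` for a closed two-form `ω` on the base, and adding to it the
fibrewise linear function `φₖ yᵏ` replaces `ω` by `ω - dφ`. -/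
theorem exists_lagrangian (hn : 3 ≤ n) (hV : IsOpen V) [ContractibleSpace V]
    {G : Fin n → E n × E n → ℝ} (hG : ∀ k, ContDiffOn ℝ ∞ (G k) (V ×ˢ {0}ᶜ))
    {h : Fin n → Fin n → E n × E n → ℝ} (hh : ∀ i j, ContDiffOn ℝ ∞ (h i j) (V ×ˢ {0}ᶜ))
    (hsymm : ∀ z ∈ V ×ˢ ({0}ᶜ : Set (E n)), ∀ i j, h j i z = h i j z)
    (hcontract : ∀ z ∈ V ×ˢ ({0}ᶜ : Set (E n)), ∀ i, ∑ j, h i j z * z.2 j = 0)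
    (hderiv : ∀ z ∈ V ×ˢ ({0}ᶜ : Set (E n)), ∀ i j k, dy k (h i j) z = dy j (h i k) z)
    (hcov : ∀ z ∈ V ×ˢ ({0}ᶜ : Set (E n)), ∀ i j, dynCov G h i j z = 0)
    (hR : ∀ z ∈ V ×ˢ ({0}ᶜ : Set (E n)), ∀ i j,
      ∑ k, h i k z * riemann G k j z = ∑ k, h j k z * riemann G k i z) :
    ∃ F : E n × E n → ℝ, ContDiffOn ℝ ∞ F (V ×ˢ {0}ᶜ) ∧
      (∀ z ∈ V ×ˢ ({0}ᶜ : Set (E n)), ∀ t : ℝ, 0 < t → F (z.1, t • z.2) = t * F z) ∧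
      (∀ z ∈ V ×ˢ ({0}ᶜ : Set (E n)), ∀ i, along G (dy i F) z - dx i F z = 0) ∧
      ∀ z ∈ V ×ˢ ({0}ᶜ : Set (E n)), ∀ i j, h i j z = dy i (dy j F) z := by
  obtain ⟨F, hF, hhom, hhess⟩ := exists_homogeneous_of_hessian hn hV hh hsymm hcontract hderiv
  set D : Set (E n × E n) := V ×ˢ {0}ᶜ
  have hD : IsOpen D := hV.prod isOpen_compl_singleton
  have hE : ∀ i, ∀ z ∈ D, eulerForm G F i z = ∑ j, horizCurl G F i j z * z.2 j := fun i z hz =>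
    eulerForm_eq_sum_horizCurl hD hF (fun z hz => sum_snd_mul_dy_eq hD hF hhom hz) hh hhess hcov
      hz i
  have hdy0 : ∀ z ∈ D, ∀ i j k, dy k (horizCurl G F i j) z = 0 := fun z hz i j k =>
    dy_horizCurl_eq_zero hD hG hF hhess hcov hz i j k
  have hcs := fun i j => smooth_horizCurl hD hG hF i j
  set b : E n := EuclideanSpace.single ⟨0, by omega⟩ 1
  have hb : b ≠ 0 := by simp [b]
  -- `ω` as a two-form on the base, read off at the fibre coordinate `b`
  set w : Fin n → Fin n → E n → ℝ := fun i j x => horizCurl G F i j (x, b)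
  have hw : ∀ i j, ContDiffOn ℝ ∞ (w i j) V := fun i j =>
    (hcs i j).comp (ContDiff.contDiffOn (by fun_prop)) fun x hx => ⟨hx, hb⟩
  have hwd : ∀ i j, ∀ x ∈ V, DifferentiableAt ℝ (w i j) x := fun i j x hx =>
    ((hw i j).contDiffAt (hV.mem_nhds hx)).differentiableAt (by simp)
  have hcw : ∀ i j, ∀ z ∈ D, horizCurl G F i j z = w i j z.1 := fun i j z hz =>
    eq_of_dy_eq_zero hn hV (hcs i j) (fun z hz => hdy0 z hz i j) hz.1 hz.2 hb
  have hfw : ∀ i j, ∀ z ∈ D, ∀ p, fderiv ℝ (horizCurl G F i j) z p =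
      fderiv ℝ (w i j) z.1 p.1 := fun i j z hz p => by
    rw [fderiv_congr_of_eqOn (g := fun z => w i j z.1) hD (hcw i j) hz,
      fderiv_comp_fst (hwd i j z.1 hz.1)]
  -- the derivative of `ω` along the spray gives the contraction of `dω` with `y`
  have hdω : ∀ z ∈ D, ∀ i j, fderiv ℝ (w i j) z.1 z.2 =
      ∑ l, fderiv ℝ (w i l) z.1 (EuclideanSpace.single j 1) * z.2 l -
      ∑ l, fderiv ℝ (w j l) z.1 (EuclideanSpace.single i 1) * z.2 l := by
    intro z hz i j
    have h1 := along_horizCurl hD hG hF hhess hz i j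
    have h2 : ∀ i j, horiz G j (eulerForm G F i) z =
        ∑ l, fderiv ℝ (w i l) z.1 (EuclideanSpace.single j 1) * z.2 l -
          ∑ l, conn G l j z * horizCurl G F i l z := by
      intro i j
      rw [horiz_congr hD (hE i) hz, horiz_eq_fderiv, fderiv_sum_mul
        (fun l => differentiableAt_of_smooth hD (hcs i l) hz) fun l => by fun_prop,
        ← Finset.sum_sub_distrib]
      refine Finset.sum_congr rfl fun l _ => ?_
      rw [fderiv_snd_coord, hfw i l z hz, horizVector]
      ring
    rw [hR z hz, sub_self, add_zero, along_eq_fderiv, hfw i j z hz, h2, h2, sprayVector] at h1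
    rw [h1]
    ring
  have halt : ∀ x ∈ V, ∀ i j, w i j x = -w j i x := fun x _ i j => horizCurl_swap i j
  have haltd : ∀ x ∈ V, ∀ i j u, fderiv ℝ (w i j) x u = -fderiv ℝ (w j i) x u := by
    intro x hx i j u
    have e : w i j =ᶠ[nhds x] fun x => -w j i x := by
      filter_upwards [hV.mem_nhds hx] with y hy using halt y hy i j
    rw [e.fderiv_eq, fderiv_fun_neg, neg_apply]
  obtain ⟨φ, hφ, hφd⟩ := exists_potential_of_closed hV hw halt fun x hx i j k => by
    -- the contraction of `dω` with the `k`-th basis vector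
    have h1 := hdω (x, EuclideanSpace.single k 1) ⟨hx, by simp⟩ i j
    simp only [PiLp.single_apply, mul_ite, mul_one, mul_zero, Finset.sum_ite_eq',
      Finset.mem_univ, if_true] at h1
    have h2 := haltd x hx k i (EuclideanSpace.single j 1)
    linarith
  have hφD : ∀ k, ∀ z ∈ D, DifferentiableAt ℝ (φ k) z.1 := fun k z hz =>
    ((hφ k).contDiffAt (hV.mem_nhds hz.1)).differentiableAt (by simp)
  have hφs : ∀ k, ContDiffOn ℝ ∞ (fun z : E n × E n => φ k z.1) D := fun k =>
    (hφ k).comp contDiff_fst.contDiffOn fun z hz => hz.1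
  have hlin : ContDiffOn ℝ ∞ (fun z : E n × E n => ∑ k, φ k z.1 * z.2 k) D :=
    ContDiffOn.sum fun k _ => (hφs k).mul (contDiff_snd_coord k).contDiffOn
  have hfd : ∀ z ∈ D, ∀ p, fderiv ℝ (fun z => F z + ∑ k, φ k z.1 * z.2 k) z p =
      fderiv ℝ F z p + ∑ k, (fderiv ℝ (φ k) z.1 p.1 * z.2 k + φ k z.1 * p.2 k) := by
    intro z hz p
    rw [fderiv_fun_add (differentiableAt_of_smooth hD hF hz)
      (differentiableAt_of_smooth hD hlin hz), add_apply,
      fderiv_sum_mul (fun k => differentiableAt_of_smooth hD (hφs k) hz) fun k => by fun_prop]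
    simp only [fderiv_snd_coord, fderiv_comp_fst (hφD _ z hz)]
  have hdyF : ∀ i, ∀ z ∈ D, dy i (fun z => F z + ∑ k, φ k z.1 * z.2 k) z =
      dy i F z + φ i z.1 := fun i z hz => by
    rw [dy, hfd z hz, dy]
    simp
  have hfdd : ∀ i, ∀ z ∈ D, ∀ p, fderiv ℝ (dy i fun z => F z + ∑ k, φ k z.1 * z.2 k) z p =
      fderiv ℝ (dy i F) z p + fderiv ℝ (φ i) z.1 p.1 := fun i z hz p => by
    rw [fderiv_congr_of_eqOn hD (hdyF i) hz, fderiv_fun_add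
      (differentiableAt_of_smooth hD (smooth_dy hD hF i) hz)
      (differentiableAt_of_smooth hD (hφs i) hz), add_apply, fderiv_comp_fst (hφD i z hz)]
  refine ⟨fun z => F z + ∑ k, φ k z.1 * z.2 k, hF.add hlin, fun z hz t ht => ?_,
    fun z hz i => ?_, fun z hz i j => ?_⟩
  · simp only [hhom z hz t ht, PiLp.smul_apply, smul_eq_mul, mul_add, Finset.mul_sum]
    congr 1
    exact Finset.sum_congr rfl fun k _ => by ring
  · have h1 := hE i z hz
    rw [eulerForm, along_eq_fderiv] at h1
    have h2 : fderiv ℝ (φ i) z.1 z.2 - ∑ k, fderiv ℝ (φ k) z.1 (EuclideanSpace.single i 1) *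
        z.2 k = -∑ k, horizCurl G F i k z * z.2 k := by
      rw [fderiv_eq_sum_single, ← Finset.sum_sub_distrib, ← Finset.sum_neg_distrib]
      refine Finset.sum_congr rfl fun k _ => ?_
      rw [hcw i k z hz, ← hφd z.1 hz.1 i k]
      ring
    rw [along_eq_fderiv, hfdd i z hz, dx, hfd z hz]
    simp only [PiLp.zero_apply, mul_zero, add_zero]
    rw [dx] at h1
    simp only [sprayVector] at h1 ⊢
    linarith
  · rw [dy, hfdd j z hz, hhess z hz, dy]
    simp

end Construction

/-! ### Passing to the coordinates of a chart -/

section ChartDomain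

variable {n : ℕ} {M : Type*} [TopologicalSpace M] {e : OpenPartialHomeomorph M (E n)} {U : Set M}

theorem isOpen_image_chart (hUopen : IsOpen U) (hUe : U ⊆ e.source) : IsOpen (e '' U) :=
  e.isOpen_image_of_subset_source hUopen hUe

theorem image_chart_subset_target (hUe : U ⊆ e.source) : e '' U ⊆ e.target := by
  rintro _ ⟨x, hx, rfl⟩
  exact e.map_source (hUe hx)

theorem isOpen_coordDomain (hUopen : IsOpen U) (hUe : U ⊆ e.source) :
    IsOpen (coordDomain e U) :=
  (isOpen_image_chart hUopen hUe).prod isOpen_compl_singleton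

theorem coordDomain_subset (hUe : U ⊆ e.source) :
    coordDomain e U ⊆ e.target ×ˢ Set.univ :=
  fun _ hz => ⟨image_chart_subset_target hUe hz.1, trivial⟩

theorem contractibleSpace_image_chart (hUe : U ⊆ e.source) [ContractibleSpace U] :
    ContractibleSpace (e '' U) :=
  (e.homeomorphOfImageSubsetSource hUe rfl).symm.contractibleSpace

end ChartDomain

section ChartCoordinates

variable {n : ℕ} {M : Type*} [TopologicalSpace M] [ChartedSpace (E n) M]
  {e : OpenPartialHomeomorph M (E n)} {U : Set M}

theorem mdifferentiable_chart_of_mem (he : e ∈ IsManifold.maximalAtlas (𝓡 n) ∞ M) :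
    e.MDifferentiable (𝓡 n) (𝓡 n) :=
  ⟨(contMDiffOn_of_mem_maximalAtlas he).mdifferentiableOn (by simp),
    (contMDiffOn_symm_of_mem_maximalAtlas he).mdifferentiableOn (by simp)⟩

variable [IsManifold (𝓡 n) ∞ M]

theorem fibreCoord_ofCoord (he : e ∈ IsManifold.maximalAtlas (𝓡 n) ∞ M) {z : E n × E n}
    (hz : z.1 ∈ e.target) : fibreCoord e (ofCoord e z) = z.2 :=
  congrArg (fun L => L z.2) ((mdifferentiable_chart_of_mem he).comp_symm_deriv hz)

theorem ofCoord_fibreCoord (he : e ∈ IsManifold.maximalAtlas (𝓡 n) ∞ M) {p : TM n M}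
    (hp : p.1 ∈ e.source) : ofCoord e (e p.1, fibreCoord e p) = p := by
  obtain ⟨x, v⟩ := p
  have h1 := congrArg (fun L => L v) ((mdifferentiable_chart_of_mem he).symm_comp_deriv hp)
  exact Bundle.TotalSpace.ext (e.left_inv hp) (heq_of_eq h1)

theorem contMDiff_totalSpace_mk :
    ContMDiff 𝓘(ℝ, E n × E n) (𝓡 n).tangent ∞
      (fun z : E n × E n => (⟨z.1, z.2⟩ : TangentBundle (𝓡 n) (E n))) := by
  intro z
  refine Bundle.contMDiffAt_totalSpace.2 ⟨contDiff_fst.contMDiff.contMDiffAt, ?_⟩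
  simpa using contDiff_snd.contMDiff.contMDiffAt

theorem contMDiffOn_ofCoord (he : e ∈ IsManifold.maximalAtlas (𝓡 n) ∞ M) :
    ContMDiffOn 𝓘(ℝ, E n × E n) (𝓡 n).tangent ∞ (ofCoord e) (e.target ×ˢ Set.univ) := by
  have h1 := (contMDiffOn_symm_of_mem_maximalAtlas he).contMDiffOn_tangentMapWithin (m := ∞)
    (by simp) e.open_target.uniqueMDiffOn
  refine (h1.comp contMDiff_totalSpace_mk.contMDiffOn fun z hz => hz.1).congr fun z hz => ?_
  have h2 : mfderivWithin (𝓡 n) (𝓡 n) e.symm e.target z.1 = mfderiv (𝓡 n) (𝓡 n) e.symm z.1 :=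
    mfderivWithin_of_isOpen e.open_target hz.1
  simp [tangentMapWithin, ofCoord, h2]

theorem isOpen_setOf_proj_mem {S : Set M} (hS : IsOpen S) : IsOpen {p : TM n M | p.1 ∈ S} :=
  hS.preimage (FiberBundle.continuous_proj (E n) (TangentSpace (𝓡 n)))

theorem contMDiffOn_fibreCoord (he : e ∈ IsManifold.maximalAtlas (𝓡 n) ∞ M) :
    ContMDiffOn (𝓡 n).tangent 𝓘(ℝ, E n) ∞ (fibreCoord e) {p : TM n M | p.1 ∈ e.source} := by
  have h1 := (contMDiffOn_of_mem_maximalAtlas he).contMDiffOn_tangentMapWithin (m := ∞)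
    (by simp) e.open_source.uniqueMDiffOn
  refine ((contMDiff_snd_tangentBundle_modelSpace (E n) (𝓡 n)).comp_contMDiffOn h1).congr
    fun p hp => ?_
  have h2 : mfderivWithin (𝓡 n) (𝓡 n) e e.source p.1 = mfderiv (𝓡 n) (𝓡 n) e p.1 :=
    mfderivWithin_of_isOpen e.open_source hp
  exact congrArg (fun L => L p.2) h2.symm

theorem fibreCoord_smul (p : TM n M) (t : ℝ) :
    fibreCoord e (⟨p.1, t • p.2⟩ : TM n M) = t • fibreCoord e p :=
  (mfderiv (𝓡 n) 𝓘(ℝ, E n) e p.1).map_smul t p.2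

theorem ofCoord_smul (z : E n × E n) (t : ℝ) :
    ofCoord e (z.1, t • z.2) = ⟨(ofCoord e z).1, t • (ofCoord e z).2⟩ :=
  congrArg (Bundle.TotalSpace.mk (F := E n) (E := TangentSpace (𝓡 n)) (e.symm z.1))
    ((mfderiv 𝓘(ℝ, E n) (𝓡 n) e.symm z.1).map_smul t z.2)

theorem ofCoord_mem_slit (he : e ∈ IsManifold.maximalAtlas (𝓡 n) ∞ M) (hUe : U ⊆ e.source)
    {z : E n × E n} (hz : z ∈ coordDomain e U) : ofCoord e z ∈ slit (n := n) U := by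
  obtain ⟨⟨x, hx, hxz⟩, hz2⟩ := hz
  refine ⟨?_, fun h0 => hz2 ?_⟩
  · change e.symm z.1 ∈ U
    rw [← hxz, e.left_inv (hUe hx)]
    exact hx
  · have h1 := fibreCoord_ofCoord he (z := z) (hxz ▸ e.map_source (hUe hx))
    rw [fibreCoord, h0, map_zero] at h1
    exact h1.symm

theorem coord_mem_coordDomain (he : e ∈ IsManifold.maximalAtlas (𝓡 n) ∞ M) (hUe : U ⊆ e.source)
    {p : TM n M} (hp : p ∈ slit U) : (e p.1, fibreCoord e p) ∈ coordDomain e U := by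
  refine ⟨⟨p.1, hp.1, rfl⟩, fun h0 => hp.2 ?_⟩
  have h1 := congrArg (fun L => L p.2)
    ((mdifferentiable_chart_of_mem he).symm_comp_deriv (hUe hp.1))
  have h2 : fibreCoord e p = 0 := h0
  exact h1.symm.trans ((congrArg (mfderiv (𝓡 n) (𝓡 n) e.symm (e p.1)) h2).trans
    (ContinuousLinearMap.map_zero _))

theorem contDiffOn_coordFun (he : e ∈ IsManifold.maximalAtlas (𝓡 n) ∞ M) (hUe : U ⊆ e.source)
    {F : TM n M → ℝ} (hF : ContMDiffOn (𝓡 n).tangent 𝓘(ℝ, ℝ) ∞ F (slit U)) :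
    ContDiffOn ℝ ∞ (coordFun e F) (coordDomain e U) :=
  (hF.comp ((contMDiffOn_ofCoord he).mono (coordDomain_subset hUe))
    fun _ hz => ofCoord_mem_slit he hUe hz).contDiffOn

/-- The function on `TM` with a given coordinate expression. Only its values over the domain of the
chart matter. -/
noncomputable def ofCoordFun (e : OpenPartialHomeomorph M (E n)) (f : E n × E n → ℝ) :
    TM n M → ℝ := fun p => f (e p.1, fibreCoord e p)

theorem coordFun_ofCoordFun (he : e ∈ IsManifold.maximalAtlas (𝓡 n) ∞ M) (hUe : U ⊆ e.source)
    (f : E n × E n → ℝ) {z : E n × E n} (hz : z ∈ coordDomain e U) :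
    coordFun e (ofCoordFun e f) z = f z := by
  have h1 := image_chart_subset_target hUe hz.1
  have h2 : e (ofCoord e z).1 = z.1 := e.right_inv h1
  rw [coordFun, ofCoordFun, h2, fibreCoord_ofCoord he h1]

theorem contMDiffOn_ofCoordFun (he : e ∈ IsManifold.maximalAtlas (𝓡 n) ∞ M)
    (hUe : U ⊆ e.source) {f : E n × E n → ℝ} (hf : ContDiffOn ℝ ∞ f (coordDomain e U)) :
    ContMDiffOn (𝓡 n).tangent 𝓘(ℝ, ℝ) ∞ (ofCoordFun e f) (slit U) := by
  have h1 : ContMDiffOn (𝓡 n).tangent 𝓘(ℝ, E n) ∞ (fun p : TM n M => e p.1) (slit U) :=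
    (contMDiffOn_of_mem_maximalAtlas he).comp
      (Bundle.contMDiff_proj (TangentSpace (𝓡 n) (M := M))).contMDiffOn fun p hp => hUe hp.1
  have h2 := (contMDiffOn_fibreCoord he).mono fun (p : TM n M) (hp : p ∈ slit U) => hUe hp.1
  exact hf.contMDiffOn.comp (h1.prodMk_space h2) fun p hp => coord_mem_coordDomain he hUe hp

theorem contMDiffOn_fibreCoord_apply (he : e ∈ IsManifold.maximalAtlas (𝓡 n) ∞ M) (i : Fin n) :
    ContMDiffOn (𝓡 n).tangent 𝓘(ℝ, ℝ) ∞ (fun q : TM n M => fibreCoord e q i)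
      {p : TM n M | p.1 ∈ e.source} :=
  (EuclideanSpace.proj (𝕜 := ℝ) i).contDiff.contMDiff.comp_contMDiffOn (contMDiffOn_fibreCoord he)

/-- The coefficients of a spray are smooth functions of the coordinates. -/
theorem contDiffOn_sprayCoeff (he : e ∈ IsManifold.maximalAtlas (𝓡 n) ∞ M)
    (hUe : U ⊆ e.source) {Γ : FieldOnTM n M} (hΓ : IsSpray Γ) (i : Fin n) :
    ContDiffOn ℝ ∞ (sprayCoeff e Γ i) (coordDomain e U) := by
  have hS : IsOpen {p : TM n M | p.1 ∈ e.source} := isOpen_setOf_proj_mem e.open_source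
  have h1 := (contMDiffOn_fibreCoord_apply he i).contMDiffOn_tangentMapWithin (m := ∞) (by simp)
    hS.uniqueMDiffOn
  have h2 := (contMDiff_snd_tangentBundle_modelSpace ℝ 𝓘(ℝ, ℝ)).comp_contMDiffOn (n := ∞) h1
  have hmem : ∀ z ∈ coordDomain e U, ofCoord e z ∈ slit (n := n) (Set.univ : Set M) ∧
      (ofCoord e z).1 ∈ e.source := fun z hz =>
    ⟨⟨trivial, (ofCoord_mem_slit he hUe hz).2⟩, hUe (ofCoord_mem_slit he hUe hz).1⟩
  have h3 := hΓ.smooth.comp ((contMDiffOn_ofCoord he).mono (coordDomain_subset hUe))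
    fun z hz => (hmem z hz).1
  have h4 := (h2.comp h3 fun z hz => (hmem z hz).2).contDiffOn
  refine ((contDiffOn_const (c := -(1 / 2 : ℝ))).mul h4).congr fun z hz => ?_
  rw [sprayCoeff, fieldOfFibreCoord]
  congr 1
  have h5 : mfderivWithin (𝓡 n).tangent 𝓘(ℝ, ℝ) (fun q : TM n M => fibreCoord e q i)
      {p : TM n M | p.1 ∈ e.source} (ofCoord e z) =
      mfderiv (𝓡 n).tangent 𝓘(ℝ, ℝ) (fun q : TM n M => fibreCoord e q i) (ofCoord e z) :=
    mfderivWithin_of_isOpen hS (hmem z hz).2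
  exact congrArg (fun L => L (Γ (ofCoord e z))) h5.symm

/-- The Liouville field differentiates the fibre coordinates to themselves. -/
theorem mfderiv_fibreCoord_liouville (he : e ∈ IsManifold.maximalAtlas (𝓡 n) ∞ M) {p : TM n M}
    (hp : p.1 ∈ e.source) (i : Fin n) :
    mfderiv (𝓡 n).tangent 𝓘(ℝ, ℝ) (fun q : TM n M => fibreCoord e q i) p (liouville p) =
      fibreCoord e p i := by
  have hS : IsOpen {p : TM n M | p.1 ∈ e.source} := isOpen_setOf_proj_mem e.open_source
  have h1 : MDifferentiableAt (𝓡 n).tangent 𝓘(ℝ, ℝ) (fun q : TM n M => fibreCoord e q i) p :=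
    ((contMDiffOn_fibreCoord_apply he i).contMDiffAt (hS.mem_nhds hp)).mdifferentiableAt (by simp)
  let L : E n →L[ℝ] E n := mfderiv (𝓡 n) 𝓘(ℝ, E n) e p.1
  -- in the chart, the inclusion of the fibre is `v ↦ (x, L v)`
  have h2 : MDifferentiableAt 𝓘(ℝ, E n) (𝓡 n).tangent
      (fun v : E n => (⟨p.1, v⟩ : TM n M)) p.2 := by
    have e1 : (fun v : E n => (⟨p.1, v⟩ : TM n M)) = fun v => ofCoord e (e p.1, L v) :=
      funext fun v => (ofCoord_fibreCoord he (p := ⟨p.1, v⟩) hp).symm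
    rw [e1]
    have e2 : ContMDiffAt 𝓘(ℝ, E n × E n) (𝓡 n).tangent ∞ (ofCoord e) (e p.1, L p.2) :=
      (contMDiffOn_ofCoord he).contMDiffAt ((e.open_target.prod isOpen_univ).mem_nhds
        ⟨e.map_source hp, trivial⟩)
    have e3 : ContDiff ℝ ∞ fun v : E n => (e p.1, L v) := by fun_prop
    exact (ContMDiffAt.comp (g := ofCoord e) (f := fun v : E n => (e p.1, L v)) p.2 e2
      e3.contMDiff.contMDiffAt).mdifferentiableAt (by simp)
  have h3 := mfderiv_comp (f := fun v : E n => (⟨p.1, v⟩ : TM n M)) p.2 h1 h2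
  have h4 : (fun q : TM n M => fibreCoord e q i) ∘ (fun v : E n => (⟨p.1, v⟩ : TM n M)) =
      (EuclideanSpace.proj (𝕜 := ℝ) i).comp L := rfl
  have h5 : ∀ v : E n, mfderiv 𝓘(ℝ, E n) 𝓘(ℝ, ℝ) ((EuclideanSpace.proj (𝕜 := ℝ) i).comp L) v =
      (EuclideanSpace.proj (𝕜 := ℝ) i).comp L := fun v => ContinuousLinearMap.mfderiv_eq _
  rw [h4] at h3
  exact congrArg (fun A => A p.2) (h3.symm.trans (h5 p.2))

/-- The coefficients of `Γ - 2 P Δ` are `Γⁱ + P yⁱ`. -/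
theorem sprayCoeff_sub_liouville (he : e ∈ IsManifold.maximalAtlas (𝓡 n) ∞ M)
    (hUe : U ⊆ e.source) {Γ Γ' : FieldOnTM n M} {P : TM n M → ℝ} {z : E n × E n}
    (hz : z ∈ coordDomain e U)
    (hΓ : Γ' (ofCoord e z) = Γ (ofCoord e z) - (2 * P (ofCoord e z)) • liouville (ofCoord e z))
    (i : Fin n) :
    sprayCoeff e Γ' i z = sprayCoeff e Γ i z + P (ofCoord e z) * z.2 i := by
  have h1 : mfderiv (𝓡 n).tangent 𝓘(ℝ, ℝ) (fun q : TM n M => fibreCoord e q i) (ofCoord e z)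
      (liouville (ofCoord e z)) = z.2 i :=
    (mfderiv_fibreCoord_liouville he (hUe (ofCoord_mem_slit he hUe hz).1) i).trans
      (by rw [fibreCoord_ofCoord he (image_chart_subset_target hUe hz.1)])
  let A : E n × E n →L[ℝ] ℝ :=
    mfderiv (𝓡 n).tangent 𝓘(ℝ, ℝ) (fun q : TM n M => fibreCoord e q i) (ofCoord e z)
  let a : E n × E n := Γ (ofCoord e z)
  let b : E n × E n := liouville (ofCoord e z)
  have h2 : A b = z.2 i := h1
  have h3 : fieldOfFibreCoord e Γ' i z = A a - 2 * P (ofCoord e z) * z.2 i :=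
    (congrArg A hΓ).trans (by
      change A (a - (2 * P (ofCoord e z)) • b) = _
      rw [map_sub, map_smul, h2, smul_eq_mul])
  have h4 : fieldOfFibreCoord e Γ i z = A a := rfl
  rw [sprayCoeff, sprayCoeff, h3, h4]
  ring

end ChartCoordinates

/-! ### Projective classes and the Weyl curvature -/

section ProjectiveClass

variable {n : ℕ}

/-- The Weyl and the Riemann curvature differ by terms that do not affect symmetry with respect to
a symmetric tensor annihilating `y`. -/
theorem sum_mul_weyl {G : Fin n → E n × E n → ℝ} {h : Fin n → Fin n → E n × E n → ℝ}
    {z : E n × E n} (hcontract : ∀ i, ∑ j, h i j z * z.2 j = 0) (i j : Fin n) :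
    ∑ k, h i k z * weyl G k j z =
      ∑ k, h i k z * riemann G k j z - riemannTrace G z * h i j z := by
  have h1 : ∑ k, h i k z * weyl G k j z = ∑ k, h i k z * riemann G k j z -
      ∑ k, riemannTrace G z * (h i k z * if k = j then 1 else 0) -
      rho G j z * ∑ k, h i k z * z.2 k := by
    rw [Finset.mul_sum, ← Finset.sum_sub_distrib, ← Finset.sum_sub_distrib]
    exact Finset.sum_congr rfl fun k _ => by rw [weyl]; ring
  rw [h1, hcontract i, ← Finset.mul_sum]
  simp

variable {M : Type*} [TopologicalSpace M] [ChartedSpace (E n) M] [IsManifold (𝓡 n) ∞ M]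
  {e : OpenPartialHomeomorph M (E n)} {U : Set M}

/-- The sprays of a projective class have the same Euler-Lagrange equations for a Lagrangian whose
Hessian annihilates `y`. -/
theorem along_sprayCoeff_eq (he : e ∈ IsManifold.maximalAtlas (𝓡 n) ∞ M) (hUe : U ⊆ e.source)
    {S : Set (FieldOnTM n M)} (hS : IsProjectiveClass S) {Γ Γ' : FieldOnTM n M} (hΓ : Γ ∈ S)
    (hΓ' : Γ' ∈ S) {f : E n × E n → ℝ} {z : E n × E n} (hz : z ∈ coordDomain e U)
    (hf : ∑ k, z.2 k * dy k f z = 0) :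
    along (sprayCoeff e Γ) f z = along (sprayCoeff e Γ') f z := by
  obtain ⟨Γ₀, -, rfl⟩ := hS
  have key : ∀ Γ : FieldOnTM n M, ProjEquiv Γ₀ Γ →
      along (sprayCoeff e Γ) f z = along (sprayCoeff e Γ₀) f z := by
    rintro Γ ⟨P, -, hP⟩
    have h1 := sprayCoeff_sub_liouville he hUe hz
      (hP _ ⟨trivial, (ofCoord_mem_slit he hUe hz).2⟩).2
    have h2 : along (sprayCoeff e Γ) f z = along (sprayCoeff e Γ₀) f z -
        2 * P (ofCoord e z) * ∑ k, z.2 k * dy k f z := by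
      rw [along, along, Finset.mul_sum, ← Finset.sum_sub_distrib]
      exact Finset.sum_congr rfl fun k _ => by rw [h1]; ring
    rw [h2, hf, mul_zero, sub_zero]
  rw [key Γ hΓ.2, key Γ' hΓ'.2]

theorem coordFun_smul {F : TM n M → ℝ} (he : e ∈ IsManifold.maximalAtlas (𝓡 n) ∞ M)
    (hUe : U ⊆ e.source) (hF : IsPosHomogeneous U F) {z : E n × E n} (hz : z ∈ coordDomain e U)
    {t : ℝ} (ht : 0 < t) : coordFun e F (z.1, t • z.2) = t * coordFun e F z := by
  rw [coordFun, ofCoord_smul]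
  exact hF.hom _ (ofCoord_mem_slit he hUe hz) t ht

theorem isPosHomogeneous_ofCoordFun (he : e ∈ IsManifold.maximalAtlas (𝓡 n) ∞ M)
    (hUe : U ⊆ e.source) {f : E n × E n → ℝ} (hf : ContDiffOn ℝ ∞ f (coordDomain e U))
    (hhom : ∀ z ∈ coordDomain e U, ∀ t : ℝ, 0 < t → f (z.1, t • z.2) = t * f z) :
    IsPosHomogeneous U (ofCoordFun e f) where
  smooth := contMDiffOn_ofCoordFun he hUe hf
  hom p hp t ht := by
    rw [ofCoordFun, fibreCoord_smul]
    exact hhom _ (coord_mem_coordDomain he hUe hp) t ht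

/-- The tensor field along the projection with given components in a chart. Only its values over the
domain of the chart matter. -/
noncomputable def ofTensorCoeff (e : OpenPartialHomeomorph M (E n))
    (a : Fin n → Fin n → E n × E n → ℝ) : TensorAlong n M := fun p =>
  let L : TangentSpace (𝓡 n) p.1 →ₗ[ℝ] Fin n → ℝ :=
    (EuclideanSpace.equiv (Fin n) ℝ).toLinearMap ∘ₗ
      (mfderiv (𝓡 n) 𝓘(ℝ, E n) e p.1).toLinearMap
  (Matrix.toBilin' (Matrix.of fun i j => a i j (e p.1, fibreCoord e p))).comp L L

theorem tensorCoeff_ofTensorCoeff (he : e ∈ IsManifold.maximalAtlas (𝓡 n) ∞ M)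
    (hUe : U ⊆ e.source) (a : Fin n → Fin n → E n × E n → ℝ) {z : E n × E n}
    (hz : z ∈ coordDomain e U) (i j : Fin n) :
    tensorCoeff e (ofTensorCoeff e a) i j z = a i j z := by
  have h1 := image_chart_subset_target hUe hz.1
  have h2 : ∀ v : E n, mfderiv (𝓡 n) 𝓘(ℝ, E n) e (e.symm z.1)
      (mfderiv 𝓘(ℝ, E n) (𝓡 n) e.symm z.1 v) = v := fun v =>
    congrArg (fun L => L v) ((mdifferentiable_chart_of_mem he).comp_symm_deriv h1)
  have h3 : (e (ofCoord e z).1, fibreCoord e (ofCoord e z)) = z :=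
    Prod.ext (e.right_inv h1) (fibreCoord_ofCoord he h1)
  have h4 : tensorCoeff e (ofTensorCoeff e a) i j z =
      Matrix.toBilin' (Matrix.of fun i j => a i j (e (ofCoord e z).1, fibreCoord e (ofCoord e z)))
        (EuclideanSpace.equiv (Fin n) ℝ (mfderiv (𝓡 n) 𝓘(ℝ, E n) e (e.symm z.1)
          (mfderiv 𝓘(ℝ, E n) (𝓡 n) e.symm z.1 (EuclideanSpace.single i 1))))
        (EuclideanSpace.equiv (Fin n) ℝ (mfderiv (𝓡 n) 𝓘(ℝ, E n) e (e.symm z.1)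
          (mfderiv 𝓘(ℝ, E n) (𝓡 n) e.symm z.1 (EuclideanSpace.single j 1)))) := rfl
  rw [h4, h3]
  refine (congrArg₂ (fun u v => Matrix.toBilin' (Matrix.of fun i j => a i j z)
    (EuclideanSpace.equiv (Fin n) ℝ u) (EuclideanSpace.equiv (Fin n) ℝ v))
    (h2 _) (h2 _)).trans ?_
  exact Matrix.toBilin'_single _ i j

/-- A given tensor field satisfies the Helmholtz-like conditions if and only if it is the Hessian
of a Lagrangian of the projective class that is homogeneous of degree one. -/
theorem exists_hessian_iff_helmholtz (hn : 3 ≤ n)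
    (he : e ∈ IsManifold.maximalAtlas (𝓡 n) ∞ M) (hUopen : IsOpen U) (hUe : U ⊆ e.source)
    [ContractibleSpace U] {S : Set (FieldOnTM n M)} (hS : IsProjectiveClass S)
    {h : TensorAlong n M} (hh : SmoothTensorOn e U h) {Γ : FieldOnTM n M} (hΓ : Γ ∈ S) :
    (∃ F : TM n M → ℝ, IsPosHomogeneous U F ∧ (∀ Γ' ∈ S, EulerLagrange e U Γ' F) ∧
      IsHessian e U F h) ↔ HelmholtzConditions e U Γ h := by
  have hD := isOpen_coordDomain hUopen hUe
  have hspray : IsSpray Γ := by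
    obtain ⟨Γ₀, -, rfl⟩ := hS
    exact hΓ.1
  have hG := fun i => contDiffOn_sprayCoeff he hUe hspray i
  constructor
  · rintro ⟨F, hF, hEL, hH⟩
    have hf := contDiffOn_coordFun he hUe hF.smooth
    have hcontract : ∀ z ∈ coordDomain e U, ∀ i, ∑ j, tensorCoeff e h i j z * z.2 j = 0 := by
      intro z hz i
      simp only [hH z hz]
      exact sum_hessian_mul_snd_eq_zero hD hf (fun z hz => sum_snd_mul_dy_eq hD hf
        (fun z hz t ht => coordFun_smul he hUe hF hz ht) hz) hz i
    have hsymm : ∀ z ∈ coordDomain e U, ∀ i j, tensorCoeff e h j i z = tensorCoeff e h i j z :=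
      fun z hz i j => by rw [hH z hz, hH z hz, dy_dy_comm hD hf hz]
    have key := fun z hz i j => helmholtz_of_eulerForm_eq_zero hD hG hf hH (hEL Γ hΓ) (z := z)
      hz i j
    refine ⟨hsymm, hcontract, fun z hz i j k => ?_, fun z hz i j => (key z hz i j).1,
      fun z hz i j => ?_⟩
    · rw [dy_congr hD (fun w hw => (hsymm w hw j i).trans (hH w hw j i)) hz,
        dy_congr hD (fun w hw => (hsymm w hw k i).trans (hH w hw k i)) hz,
        dy_dy_comm hD (smooth_dy hD hf i) hz]
    · rw [sum_mul_weyl (hcontract z hz), sum_mul_weyl (hcontract z hz), (key z hz i j).2,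
        hsymm z hz i j]
  · intro hc
    have := contractibleSpace_image_chart hUe
    obtain ⟨f, hf, hhom, hEL, hH⟩ := exists_lagrangian hn (isOpen_image_chart hUopen hUe) hG hh
      hc.symm hc.contract hc.deriv_symm hc.dynCov_eq_zero fun z hz i j => by
        have h1 := hc.weyl_symm z hz i j
        rw [sum_mul_weyl (hc.contract z hz), sum_mul_weyl (hc.contract z hz),
          hc.symm z hz i j] at h1
        linarith
    have hFf : ∀ z ∈ coordDomain e U, coordFun e (ofCoordFun e f) z = f z := fun z hz =>
      coordFun_ofCoordFun he hUe f hz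
    have hdy : ∀ i, ∀ z ∈ coordDomain e U, dy i (coordFun e (ofCoordFun e f)) z = dy i f z :=
      fun i z hz => dy_congr hD hFf hz i
    refine ⟨ofCoordFun e f, isPosHomogeneous_ofCoordFun he hUe hf hhom, fun Γ' hΓ' z hz i => ?_,
      fun z hz i j => ?_⟩
    · rw [along_congr hD (hdy i) hz, dx_congr hD hFf hz, along_sprayCoeff_eq he hUe hS hΓ' hΓ hz]
      · exact hEL z hz i
      · rw [← hc.contract z hz i]
        exact Finset.sum_congr rfl fun k _ => by
          rw [hH z hz, dy_dy_comm hD hf hz, mul_comm]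
    · rw [dy_congr hD (hdy j) hz, hH z hz]

end ProjectiveClass

end SprayGeometry

theorem mainTheorem1 {n : ℕ} (hn : 3 ≤ n) {M : Type*} [TopologicalSpace M]
    [ChartedSpace (SprayGeometry.E n) M] [IsManifold (𝓡 n) ∞ M]
    (e : OpenPartialHomeomorph M (SprayGeometry.E n))
    (he : e ∈ IsManifold.maximalAtlas (𝓡 n) ∞ M)
    (U : Set M) (hUopen : IsOpen U) (hUe : U ⊆ e.source) (hU : ContractibleSpace U)
    (S : Set (SprayGeometry.FieldOnTM n M)) (hS : SprayGeometry.IsProjectiveClass S) :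
    (∀ Γ ∈ S,
      ((∃ F : SprayGeometry.TM n M → ℝ, SprayGeometry.IsPosHomogeneous U F ∧
          ∀ Γ' ∈ S, SprayGeometry.EulerLagrange e U Γ' F) ↔
        ∃ h : SprayGeometry.TensorAlong n M, SprayGeometry.SmoothTensorOn e U h ∧
          SprayGeometry.HelmholtzConditions e U Γ h)) ∧
    (∀ h : SprayGeometry.TensorAlong n M, SprayGeometry.SmoothTensorOn e U h → ∀ Γ ∈ S,
      ((∃ F : SprayGeometry.TM n M → ℝ, SprayGeometry.IsPosHomogeneous U F ∧
          (∀ Γ' ∈ S, SprayGeometry.EulerLagrange e U Γ' F) ∧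
          SprayGeometry.IsHessian e U F h) ↔
        SprayGeometry.HelmholtzConditions e U Γ h)) := by
  have key := fun (h : SprayGeometry.TensorAlong n M) (hh : SprayGeometry.SmoothTensorOn e U h)
    Γ (hΓ : Γ ∈ S) =>
    SprayGeometry.exists_hessian_iff_helmholtz hn he hUopen hUe hS hh hΓ
  refine ⟨fun Γ hΓ => ⟨?_, ?_⟩, key⟩
  · rintro ⟨F, hF, hEL⟩
    set f := SprayGeometry.coordFun e F
    set h := SprayGeometry.ofTensorCoeff e fun i j =>
      SprayGeometry.dy i (SprayGeometry.dy j f)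
    have hH : SprayGeometry.IsHessian e U F h := fun z hz i j =>
      SprayGeometry.tensorCoeff_ofTensorCoeff he hUe _ hz i j
    have hD := SprayGeometry.isOpen_coordDomain hUopen hUe
    have hf := SprayGeometry.contDiffOn_coordFun he hUe hF.smooth
    have hh : SprayGeometry.SmoothTensorOn e U h := fun i j =>
      (SprayGeometry.smooth_dy hD (SprayGeometry.smooth_dy hD hf j) i).congr
        fun z hz => hH z hz i j
    exact ⟨h, hh, (key h hh Γ hΓ).1 ⟨F, hF, hEL, hH⟩⟩
  · rintro ⟨h, hh, hc⟩
    obtain ⟨F, hF, hEL, -⟩ := (key h hh Γ hΓ).2 hc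
    exact ⟨F, hF, hEL⟩
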